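/- Let $S\subset\mathbb{P}^3_{\mathbb{R}}$ be the real quadric $w^2=x^2+y^2+z^2$ (the sphere) and let $\pi\colon S\dashrightarrow\mathbb{P}^1$, $(w:x:y:z)\mapsto(w:z)$. Let $\mathrm{Bir}(S/\pi)$ be the group of birational maps $g\colon S\dashrightarrow S$ defined over $\mathbb{R}$ with $\pi\circ g=\pi$. For $t\in\mathbb{C}$ let $\Gamma_t=\{(w:x:y:z)\in S(\mathbb{C}) : z=tw\}$ be the conic that is the closure of the fibre of $\pi$ over $(1:t)$. If $\mathcal{A}\in\mathrm{Bir}(S/\pi)$ has order $2$, then for general $t$ the restriction of $\mathcal{A}$ to $\Gamma_t$ extends to an automorphism of $\Gamma_t$ with exactly two fixed points. Let $\mathrm{Fix}(\mathcal{A})$, the curve of fixed points of $\mathcal{A}$, be the Zariski closure, in $\mathbb{P}^3\times\mathbb{A}^1$, of the set of the pairs $(p,t)$ with $t$ general and $p\in\Gamma_t$ fixed by this automorphism. It is a curve defined over $\mathbb{R}$, contained in the conic bundle $\{(p,t): p\in\Gamma_t\}$, and it is of degree $2$ over the base through the projection $(p,t)\mapsto t$, again denoted by $\pi$. **Theorem.**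 Let $\mathcal{A},\mathcal{B}\in\mathrm{Bir}(S/\pi)$ be of order $2$. Then $\mathcal{A}$ and $\mathcal{B}$ are conjugate in $\mathrm{Bir}(S/\pi)$ if and only if there is a birational map $\rho\colon\mathrm{Fix}(\mathcal{A})\dashrightarrow\mathrm{Fix}(\mathcal{B})$ defined over $\mathbb{R}$ with $\pi\circ\rho=\pi$. -/

import Mathlib

namespace RealSphere

open MvPolynomial
open scoped LinearAlgebra.Projectivization

/-! ## The sphere and its dominant rational self-maps -/

/-- Complex points of the affine cone over the real projective quadric
`S : w ^ 2 = x ^ 2 + y ^ 2 + z ^ 2` in `ℙ³`; the homogeneous coordinates `(w : x : y : z)` are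
indexed by `0, 1, 2, 3`. -/
def cone : Set (Fin 4 → ℂ) := {v | v 0 ^ 2 = v 1 ^ 2 + v 2 ^ 2 + v 3 ^ 2}

/-- Value at a complex vector of a tuple of polynomials with real coefficients. -/
noncomputable def ev (F : Fin 4 → MvPolynomial (Fin 4) ℝ) (v : Fin 4 → ℂ) : Fin 4 → ℂ :=
  fun i => aeval v (F i)

/-- The parametrization of the cone that comes from `S_ℂ ≅ ℙ¹ × ℙ¹`. -/
noncomputable def param : Fin 4 → MvPolynomial (Fin 4) ℂ :=
  ![X 0 * X 2 + X 1 * X 3, C Complex.I * (X 0 * X 3 - X 1 * X 2),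
    X 0 * X 3 + X 1 * X 2, X 0 * X 2 - X 1 * X 3]

theorem param_mem (a : Fin 4 → ℂ) : (fun i => eval a (param i)) ∈ cone := by
  simp only [cone, param, Set.mem_ofPred_eq, Matrix.cons_val_zero, Matrix.cons_val_one,
    Matrix.cons_val]
  simp only [map_add, map_sub, map_mul, eval_X, eval_C]
  linear_combination (-(a 0 * a 3 - a 1 * a 2) ^ 2) * Complex.I_sq

theorem exists_param {v : Fin 4 → ℂ} (hv : v ∈ cone) :
    ∃ a : Fin 4 → ℂ, (fun i => eval a (param i)) = v := by
  have hI := Complex.I_sq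
  have hv' : (v 0 + v 3) * (v 0 - v 3) = (v 2 - Complex.I * v 1) * (v 2 + Complex.I * v 1) := by
    have : v 0 ^ 2 = v 1 ^ 2 + v 2 ^ 2 + v 3 ^ 2 := hv
    linear_combination this + (v 1) ^ 2 * hI
  by_cases h : v 0 + v 3 = 0
  · by_cases h2 : v 2 - Complex.I * v 1 = 0
    · refine ⟨![0, 1, (v 2 + Complex.I * v 1) / 2, (v 0 - v 3) / 2], ?_⟩
      funext i
      fin_cases i <;> simp [param]
      · linear_combination (-1 / 2) * h
      · linear_combination (-Complex.I / 2) * h2 - (v 1) * hI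
      · linear_combination (-1 / 2) * h2
      · linear_combination (-1 / 2) * h
    · have h3 : v 2 + Complex.I * v 1 = 0 := by
        rw [h, zero_mul] at hv'
        rcases mul_eq_zero.1 hv'.symm with h' | h'
        · exact absurd h' h2
        · exact h'
      refine ⟨![v 2 - Complex.I * v 1, v 0 - v 3, 0, 1 / 2], ?_⟩
      funext i
      fin_cases i <;> simp [param]
      · linear_combination (-1 / 2) * h
      · linear_combination (Complex.I / 2) * h3 - (v 1) * hI
      · linear_combination (-1 / 2) * h3
      · linear_combination (-1 / 2) * h
  · refine ⟨![v 0 + v 3, v 2 + Complex.I * v 1, 1 / 2,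
      (v 2 - Complex.I * v 1) / (2 * (v 0 + v 3))], ?_⟩
    have key : (v 2 + Complex.I * v 1) * ((v 2 - Complex.I * v 1) / (2 * (v 0 + v 3)))
        = (v 0 - v 3) / 2 := by
      field_simp
      linear_combination -hv'
    have key2 : (v 0 + v 3) * ((v 2 - Complex.I * v 1) / (2 * (v 0 + v 3)))
        = (v 2 - Complex.I * v 1) / 2 := by
      field_simp
    funext i
    fin_cases i <;> simp only [param, Fin.zero_eta, Fin.mk_one, Fin.reduceFinMk,
      Matrix.cons_val_zero, Matrix.cons_val_one, Matrix.cons_val, map_add, map_sub, map_mul,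
      eval_X, eval_C]
    · linear_combination key
    · linear_combination Complex.I * key2 - (v 1) * hI
    · linear_combination key2
    · linear_combination -key

/-- The sphere is irreducible. -/
theorem vanish_of_mul {f g : MvPolynomial (Fin 4) ℝ}
    (h : ∀ v ∈ cone, aeval v f * aeval v g = 0) :
    (∀ v ∈ cone, aeval v f = 0) ∨ (∀ v ∈ cone, aeval v g = 0) := by
  have conv : ∀ (q : MvPolynomial (Fin 4) ℝ) (a : Fin 4 → ℂ),
      eval a (aeval param q) = aeval (fun i => eval a (param i)) q := by
    intro q a
    induction q using MvPolynomial.induction_on with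
    | C r => simp [MvPolynomial.algebraMap_eq, IsScalarTower.algebraMap_apply ℝ ℂ (MvPolynomial (Fin 4) ℂ)]
    | add p q hp hq => simp only [map_add, hp, hq]
    | mul_X p i hp => simp only [map_mul, hp, aeval_X]
  have h0 : aeval param f * aeval param g = 0 := by
    apply MvPolynomial.funext
    intro a
    rw [map_mul, conv, conv, map_zero]
    exact h _ (param_mem a)
  have fin : ∀ q : MvPolynomial (Fin 4) ℝ, aeval param q = 0 → ∀ v ∈ cone, aeval v q = 0 := by
    intro q hq v hv
    obtain ⟨a, rfl⟩ := exists_param hv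
    rw [← conv, hq, map_zero]
  rcases mul_eq_zero.1 h0 with h | h
  · exact Or.inl (fin f h)
  · exact Or.inr (fin g h)

/-- A quadruple of real forms of the same degree that represents a dominant rational map
`S ⇢ S` defined over `ℝ`. By dominance the forms do not all vanish on `S`
(see `DomRep.exists_ne`). -/
structure DomRep where
  forms : Fin 4 → MvPolynomial (Fin 4) ℝ
  deg : ℕ
  homog : ∀ i, (forms i).IsHomogeneous deg
  mapsTo : ∀ v ∈ cone, ev forms v ∈ cone
  dominant : ∀ (f : MvPolynomial (Fin 4) ℝ) (d : ℕ), f.IsHomogeneous d →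
    (∀ v ∈ cone, aeval (ev forms v) f = 0) → ∀ v ∈ cone, aeval v f = 0

theorem X_zero_ne : ¬ ∀ v ∈ cone, aeval v (X 0 : MvPolynomial (Fin 4) ℝ) = 0 := by
  intro h
  have := h ![1, 0, 0, 1] (by simp [cone])
  simp at this

theorem ev_smul {F : Fin 4 → MvPolynomial (Fin 4) ℝ} {d : ℕ} (h : ∀ i, (F i).IsHomogeneous d)
    (c : ℂ) (v : Fin 4 → ℂ) : ev F (c • v) = c ^ d • ev F v := by
  funext i
  simp only [ev, Pi.smul_apply, smul_eq_mul]
  have h1 : aeval (c • v) (F i) = eval (c • v) (MvPolynomial.map (algebraMap ℝ ℂ) (F i)) := by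
    rw [eval_map]; rfl
  have h2 : aeval v (F i) = eval v (MvPolynomial.map (algebraMap ℝ ℂ) (F i)) := by
    rw [eval_map]; rfl
  rw [h1, h2]
  have h3 := (h i).map (algebraMap ℝ ℂ)
  rw [eval_eq, eval_eq, Finset.mul_sum]
  refine Finset.sum_congr rfl fun m hm => ?_
  have hd : m.degree = d := by
    have := h3 (mem_support_iff.1 hm)
    rwa [Finsupp.degree_eq_weight_one]
  simp only [Pi.smul_apply, smul_eq_mul, mul_pow, Finset.prod_mul_distrib]
  rw [Finset.prod_pow_eq_pow_sum, show ∑ i ∈ m.support, m i = d from hd]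
  ring

theorem ev_bind (G F : Fin 4 → MvPolynomial (Fin 4) ℝ) (v : Fin 4 → ℂ) :
    ev (fun i => bind₁ F (G i)) v = ev G (ev F v) := by
  funext i
  simp only [ev, aeval_bind₁]
  rfl

theorem aeval_bind (f : MvPolynomial (Fin 4) ℝ) (F : Fin 4 → MvPolynomial (Fin 4) ℝ)
    (v : Fin 4 → ℂ) : aeval v (bind₁ F f) = aeval (ev F v) f := by
  rw [aeval_bind₁]; rfl

theorem bind_homog {f : MvPolynomial (Fin 4) ℝ} {F : Fin 4 → MvPolynomial (Fin 4) ℝ} {d e : ℕ}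
    (hf : f.IsHomogeneous d) (hF : ∀ i, (F i).IsHomogeneous e) :
    (bind₁ F f).IsHomogeneous (e * d) :=
  hf.aeval _ hF

namespace DomRep

theorem exists_ne (F : DomRep) : ∃ k, ¬ ∀ v ∈ cone, aeval v (F.forms k) = 0 := by
  by_contra! h
  refine X_zero_ne (F.dominant (X 0) 1 (isHomogeneous_X _ _) fun v hv => ?_)
  simpa [ev] using h 0 v hv

/-- To check an identity on `S` it suffices to check it where a given map is defined. -/
theorem vanish_of_ne (F : DomRep) {f : MvPolynomial (Fin 4) ℝ}
    (h : ∀ v ∈ cone, ev F.forms v ≠ 0 → aeval v f = 0) : ∀ v ∈ cone, aeval v f = 0 := by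
  obtain ⟨k, hk⟩ := F.exists_ne
  refine (vanish_of_mul (f := f) (g := F.forms k) fun v hv => ?_).resolve_right hk
  by_cases hF : ev F.forms v = 0
  · have : aeval v (F.forms k) = 0 := congrFun hF k
    rw [this, mul_zero]
  · rw [h v hv hF, zero_mul]

/-- Two quadruples of forms define the same rational map if they are proportional on `S`. -/
def Same (F G : DomRep) : Prop :=
  ∀ v ∈ cone, ∀ i j, ev F.forms v i * ev G.forms v j = ev F.forms v j * ev G.forms v i

theorem exists_smul {a b : Fin 4 → ℂ} (ha : a ≠ 0)
    (h : ∀ i j, a i * b j = a j * b i) : ∃ c : ℂ, b = c • a := by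
  obtain ⟨k, hk⟩ := Function.ne_iff.1 ha
  refine ⟨b k / a k, ?_⟩
  have hk' : a k ≠ 0 := hk
  funext i
  simp only [Pi.smul_apply, smul_eq_mul]
  field_simp
  linear_combination h k i

theorem same_trans {F G H : DomRep} (h1 : Same F G) (h2 : Same G H) : Same F H := by
  intro v hv i j
  have key := G.vanish_of_ne
    (f := F.forms i * H.forms j - F.forms j * H.forms i) (fun v hv hG => by
      obtain ⟨c, hc⟩ := exists_smul hG (b := ev F.forms v)
        (fun i j => by linear_combination h1 v hv j i)
      obtain ⟨e, he⟩ := exists_smul hG (h2 v hv)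
      have hc' : ∀ i, aeval v (F.forms i) = c * ev G.forms v i := fun i => congrFun hc i
      have he' : ∀ i, aeval v (H.forms i) = e * ev G.forms v i := fun i => congrFun he i
      rw [map_sub, map_mul, map_mul, hc', hc', he', he']
      ring) v hv
  rw [map_sub, map_mul, map_mul] at key
  exact sub_eq_zero.1 key

instance setoid : Setoid DomRep where
  r := Same
  iseqv :=
    { refl := fun F v _ i j => mul_comm _ _
      symm := fun {F G} h v hv i j => by linear_combination -h v hv i j
      trans := same_trans }

/-- The identity map. -/
noncomputable def one : DomRep where
  forms := X
  deg := 1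
  homog := fun i => isHomogeneous_X _ i
  mapsTo := fun v hv => by
    have : ev X v = v := by funext i; simp [ev]
    rwa [this]
  dominant := fun f d _ h v hv => by
    have : ev X v = v := by funext i; simp [ev]
    simpa [this] using h v hv

theorem ev_one (v : Fin 4 → ℂ) : ev one.forms v = v := by
  funext i; simp [ev, one]

/-- The composition `G ∘ F`. -/
noncomputable def comp (G F : DomRep) : DomRep where
  forms := fun i => bind₁ F.forms (G.forms i)
  deg := F.deg * G.deg
  homog := fun i => bind_homog (G.homog i) F.homog
  mapsTo := fun v hv => by
    rw [ev_bind]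
    exact G.mapsTo _ (F.mapsTo _ hv)
  dominant := fun f d hf h => by
    refine G.dominant f d hf fun v hv => ?_
    have := F.dominant (bind₁ G.forms f) _ (bind_homog hf G.homog) (fun v hv => by
      rw [aeval_bind, ← ev_bind]
      exact h v hv) v hv
    rwa [aeval_bind] at this

theorem ev_comp (G F : DomRep) (v : Fin 4 → ℂ) :
    ev (comp G F).forms v = ev G.forms (ev F.forms v) := ev_bind _ _ _

theorem comp_same {G G' F F' : DomRep} (hG : Same G G') (hF : Same F F') :
    Same (comp G F) (comp G' F') := by
  intro v hv i j
  have key := F.vanish_of_ne (f := (comp G F).forms i * (comp G' F').forms j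
      - (comp G F).forms j * (comp G' F').forms i) (fun v hv hFv => by
    obtain ⟨c, hc⟩ := exists_smul hFv (hF v hv)
    have h1 : ev (comp G' F').forms v = c ^ G'.deg • ev G'.forms (ev F.forms v) := by
      rw [ev_comp, hc, ev_smul G'.homog]
    have h1' : ∀ i, aeval v ((comp G' F').forms i)
        = c ^ G'.deg * ev G'.forms (ev F.forms v) i := fun i => congrFun h1 i
    have h2' : ∀ i, aeval v ((comp G F).forms i) = ev G.forms (ev F.forms v) i :=
      fun i => congrFun (ev_comp G F v) i
    rw [map_sub, map_mul, map_mul, h1', h1', h2', h2']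
    linear_combination c ^ G'.deg * hG _ (F.mapsTo v hv) i j) v hv
  rw [map_sub, map_mul, map_mul] at key
  exact sub_eq_zero.1 key

end DomRep

/-- Dominant rational maps `S ⇢ S` defined over `ℝ`. -/
def DomRat : Type := Quotient DomRep.setoid

/-- Dominant rational self-maps of `S` form a monoid under composition. -/
noncomputable instance : Monoid DomRat where
  mul := Quotient.map₂ DomRep.comp fun _ _ hG _ _ hF => DomRep.comp_same hG hF
  one := Quotient.mk _ DomRep.one
  mul_assoc := by
    rintro ⟨F⟩ ⟨G⟩ ⟨H⟩
    refine Quotient.sound fun v _ i j => ?_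
    simp only [DomRep.ev_comp]
    ring
  one_mul := by
    rintro ⟨F⟩
    refine Quotient.sound fun v _ i j => ?_
    simp only [DomRep.ev_comp, DomRep.ev_one]
    ring
  mul_one := by
    rintro ⟨F⟩
    refine Quotient.sound fun v _ i j => ?_
    simp only [DomRep.ev_comp, DomRep.ev_one]
    ring

/-- The group `Bir(S)` of birational self-maps of `S` defined over `ℝ`: the dominant rational
self-maps that have an inverse. -/
abbrev BirSphere : Type := DomRatˣ

/-- The quadruple `F` of forms represents the birational map `A`. -/
def Represents (F : DomRep) (A : BirSphere) : Prop :=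
  (Quotient.mk DomRep.setoid F : DomRat) = (A : DomRat)

/-- `π ∘ F = π` for the projection `π : (w : x : y : z) ↦ (w : z)`, that is, the points
`(F₀ : F₃)` and `(w : z)` of `ℙ¹` agree on `S`. -/
def DomRep.OverBase (F : DomRep) : Prop :=
  ∀ v ∈ cone, v 0 * ev F.forms v 3 = v 3 * ev F.forms v 0

theorem DomRep.OverBase.of_same {F G : DomRep} (h : DomRep.Same F G) (hF : F.OverBase) :
    G.OverBase := by
  intro v hv
  have key := F.vanish_of_ne (f := X 0 * G.forms 3 - X 3 * G.forms 0) (fun v hv hFv => by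
    obtain ⟨c, hc⟩ := DomRep.exists_smul hFv (h v hv)
    have hc' : ∀ i, aeval v (G.forms i) = c * ev F.forms v i := fun i => congrFun hc i
    rw [map_sub, map_mul, map_mul, hc', hc', aeval_X, aeval_X]
    linear_combination c * hF v hv) v hv
  rw [map_sub, map_mul, map_mul, aeval_X, aeval_X] at key
  exact sub_eq_zero.1 key

theorem DomRep.zero_not_vanish (F : DomRep) : ¬ ∀ v ∈ cone, aeval v (F.forms 0) = 0 := by
  intro h
  refine X_zero_ne (F.dominant (X 0) 1 (isHomogeneous_X _ _) fun v hv => ?_)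
  simpa [ev] using h v hv

theorem DomRep.OverBase.comp {F G : DomRep} (hG : G.OverBase) (hF : F.OverBase) :
    (DomRep.comp G F).OverBase := by
  have e : ∀ v i, aeval v ((DomRep.comp G F).forms i) = ev G.forms (ev F.forms v) i :=
    fun v i => congrFun (DomRep.ev_comp G F v) i
  have key := (vanish_of_mul (g := F.forms 0)
    (f := X 0 * (DomRep.comp G F).forms 3 - X 3 * (DomRep.comp G F).forms 0)
    (fun v hv => by
      have h1 := hF v hv
      have h2 := hG _ (F.mapsTo v hv)
      have h0 : aeval v (F.forms 0) = ev F.forms v 0 := rfl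
      rw [map_sub, map_mul, map_mul, e, e, aeval_X, aeval_X, h0]
      linear_combination v 0 * h2 + ev G.forms (ev F.forms v) 0 * h1)).resolve_right
    F.zero_not_vanish
  intro v hv
  have := key v hv
  rw [map_sub, map_mul, map_mul, aeval_X, aeval_X] at this
  exact sub_eq_zero.1 this

theorem DomRep.OverBase.inverse {F G : DomRep} (hF : F.OverBase)
    (h : DomRep.Same (DomRep.comp F G) DomRep.one) : G.OverBase := by
  have key := (vanish_of_mul (g := (DomRep.comp F G).forms 0)
    (f := X 0 * G.forms 3 - X 3 * G.forms 0)
    (fun v hv => by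
      have h1 := h v hv 0 3
      have h2 := hF _ (G.mapsTo v hv)
      rw [← DomRep.ev_comp] at h2
      rw [DomRep.ev_one] at h1
      have h0 : aeval v ((DomRep.comp F G).forms 0) = ev (DomRep.comp F G).forms v 0 := rfl
      have h3 : ∀ i, aeval v (G.forms i) = ev G.forms v i := fun _ => rfl
      rw [map_sub, map_mul, map_mul, h3, h3, aeval_X, aeval_X, h0]
      linear_combination -(ev G.forms v 0) * h1 - v 0 * h2)).resolve_right
    (DomRep.comp F G).zero_not_vanish
  intro v hv
  have := key v hv
  rw [map_sub, map_mul, map_mul, aeval_X, aeval_X] at this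
  exact sub_eq_zero.1 this

/-- The group `Bir(S/π)` of birational self-maps `A` of `S` with `π ∘ A = π`. -/
def BirOverBase : Subgroup BirSphere where
  carrier := {A | ∃ F, Represents F A ∧ F.OverBase}
  mul_mem' := by
    rintro A B ⟨F, hF, hF'⟩ ⟨G, hG, hG'⟩
    refine ⟨DomRep.comp F G, ?_, hF'.comp hG'⟩
    unfold Represents at *
    rw [Units.val_mul, ← hF, ← hG]
    rfl
  one_mem' := by
    refine ⟨DomRep.one, rfl, fun v _ => ?_⟩
    rw [DomRep.ev_one, mul_comm]
  inv_mem' := by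
    rintro A ⟨F, hF, hF'⟩
    obtain ⟨G, hG⟩ := Quotient.exists_rep (A⁻¹ : BirSphere).val
    refine ⟨G, hG, hF'.inverse ?_⟩
    have h : A.val * (A⁻¹ : BirSphere).val = 1 := A.mul_inv
    rw [← hF, ← hG] at h
    exact Quotient.exact h

/-! ## The conic bundle of the fibres and the curve of fixed points -/

/-- The conic `Γ_t`: the closure in `S` of the fibre of `π` over `(1 : t)`, cut out in `S` by the
plane `z = t w`. (Equations are homogeneous, so the choice of the vector `p.rep` of homogeneous
coordinates of `p` does not matter, here and below.) -/
def fibre (t : ℂ) : Set (ℙ ℂ (Fin 4 → ℂ)) :=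
  {p | p.rep ∈ cone ∧ p.rep 3 = t * p.rep 0}

/-- Value of a quadruple of complex forms at a point of `ℙ³`, as a vector. -/
noncomputable def evPt (G : Fin 4 → MvPolynomial (Fin 4) ℂ) (p : ℙ ℂ (Fin 4 → ℂ)) : Fin 4 → ℂ :=
  fun i => eval p.rep (G i)

/-- The rational map `Γ_t ⇢ Γ_t` that is the restriction of `A` is defined at `p` and sends `p`
to `q`: some quadruple `F` of forms representing `A` does not vanish identically on `Γ_t`, and some
quadruple `G` of complex forms of one degree, proportional to `F` along `Γ_t`, is nonzero at `p`
and takes there the value `q`. -/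
def RestrictionMaps (A : BirSphere) (t : ℂ) (p q : ℙ ℂ (Fin 4 → ℂ)) : Prop :=
  ∃ F : DomRep, Represents F A ∧ (∃ r ∈ fibre t, ev F.forms r.rep ≠ 0) ∧
    ∃ (G : Fin 4 → MvPolynomial (Fin 4) ℂ) (d : ℕ), (∀ i, (G i).IsHomogeneous d) ∧
      (∀ r ∈ fibre t, ∀ i j, evPt G r i * ev F.forms r.rep j = evPt G r j * ev F.forms r.rep i) ∧
      ∃ h : evPt G p ≠ 0, Projectivization.mk ℂ (evPt G p) h = q

/-- Complex points `(p, t)` of `ℙ³ × 𝔸¹`; the pairs with `p ∈ Γ_t` form the conic bundle whose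
fibres are the conics `Γ_t`, and the projection to the base is `(p, t) ↦ t`. -/
abbrev Pt : Type := ℙ ℂ (Fin 4 → ℂ) × ℂ

/-- Value at `(p, t)` of a polynomial in the four homogeneous coordinates whose coefficients are
polynomials in the coordinate of the base, with coefficients in a subfield of `ℂ`. -/
noncomputable def value {k : Type} [CommRing k] [Algebra k ℂ]
    (f : MvPolynomial (Fin 4) (Polynomial k)) (P : Pt) : ℂ :=
  eval₂ (Polynomial.eval₂RingHom (algebraMap k ℂ) P.2) P.1.rep f

/-- Zariski closed subsets of `ℙ³ × 𝔸¹`. -/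
def IsZariskiClosed (Z : Set Pt) : Prop :=
  ∃ s : Set (MvPolynomial (Fin 4) (Polynomial ℂ)), (∀ f ∈ s, ∃ d, f.IsHomogeneous d) ∧
    Z = {P | ∀ f ∈ s, value f P = 0}

/-- Zariski closure in `ℙ³ × 𝔸¹`. -/
def zariskiClosure (T : Set Pt) : Set Pt := ⋂₀ {Z | IsZariskiClosed Z ∧ T ⊆ Z}

/-- The points fixed by the restrictions of `A` to the conics `Γ_t`, where `t` runs through the
complement of a finite set `E`. -/
def fixedPointsOff (A : BirSphere) (E : Finset ℂ) : Set Pt :=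
  {P | P.2 ∉ E ∧ P.1 ∈ fibre P.2 ∧ RestrictionMaps A P.2 P.1 P.1}

/-- The curve `Fix(A)`: the closure of the set of the points fixed by the restrictions of `A` to
the conics `Γ_t` for general `t`; intersecting over `E` makes "general" independent of choices. -/
def fixedCurve (A : BirSphere) : Set Pt := ⋂ E : Finset ℂ, zariskiClosure (fixedPointsOff A E)

/-! ## Birational maps of curves over the base -/

/-- `U` is a dense Zariski open subset of `T`. -/
def IsDenseOpenIn (U T : Set Pt) : Prop :=
  (∃ Z, IsZariskiClosed Z ∧ U = T \ Z) ∧ T ⊆ zariskiClosure U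

/-- Value at `(p, t)` of a quadruple of real polynomials, as a vector. -/
noncomputable def realValue (H : Fin 4 → MvPolynomial (Fin 4) (Polynomial ℝ)) (P : Pt) :
    Fin 4 → ℂ := fun i => value (H i) P

/-- The map `(p, t) ↦ (H(p, t), t)` over the base is everywhere defined on `U` and maps `U`
to `V`. -/
def MapsOver (H : Fin 4 → MvPolynomial (Fin 4) (Polynomial ℝ)) (U V : Set Pt) : Prop :=
  ∀ P ∈ U, ∃ h : realValue H P ≠ 0, (Projectivization.mk ℂ (realValue H P) h, P.2) ∈ V

/-- `K` inverts `H` on `U`. -/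
def InvertsOn (K H : Fin 4 → MvPolynomial (Fin 4) (Polynomial ℝ)) (U : Set Pt) : Prop :=
  ∀ P ∈ U, ∀ h : realValue H P ≠ 0,
    ∃ h' : realValue K (Projectivization.mk ℂ (realValue H P) h, P.2) ≠ 0,
      Projectivization.mk ℂ _ h' = P.1

/-- There is a birational map `T ⇢ T'` that is defined over `ℝ` and commutes with the projections
to the base: mutually inverse maps between dense open subsets, given by real polynomials that are
forms of the same degree in the coordinates of `ℙ³`. -/
def RealBirationalOverBase (T T' : Set Pt) : Prop :=
  ∃ U U' : Set Pt, IsDenseOpenIn U T ∧ IsDenseOpenIn U' T' ∧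
    ∃ H K : Fin 4 → MvPolynomial (Fin 4) (Polynomial ℝ),
      (∃ d, ∀ i, (H i).IsHomogeneous d) ∧ (∃ e, ∀ i, (K i).IsHomogeneous e) ∧
      MapsOver H U U' ∧ MapsOver K U' U ∧ InvertsOn K H U ∧ InvertsOn H K U'

end RealSphere

/-!
The function field of the sphere over that of the base is the function field of the conic
`x² + y² = (1 - t²) w²` over `ℝ(t)`, the conic of the quaternion algebra `H = (-1, 1 - t²)`. The
group `Bir(S/π)` is therefore `H* / ℝ(t)*`, acting by rotations of the conic, and the theorem is a
statement about quaternions. Denominators can be cleared, so quaternions over `ℝ[t]` suffice.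

That every element `A` of `Bir(S/π)` is a rotation is `exists_rotBir`. Over `ℂ(t)` the generic conic
is a line with parameter `s = w / (x - i y)`, and the pull-back of `s` under `A` is a rational
function that generates the field of rational functions, hence of degree one (`exists_moebius`). So
`A` acts by a homography of `s`; its invariance under complex conjugation says that a multiple of
its matrix is a quaternion.

Only the scalars act trivially (`im_eq_zero_of_rotBir_eq_one`), so the elements of order two are the
half-turns, the rotations by the pure quaternions `v` (`exists_pure_of_orderOf`). On a general conic
the fixed points of a half-turn are cut out by the polar of its axis (`restrictionMaps_iff`), and
this polar curve is parametrized by the double cover `r² = v²` of the base (`Frame`). Over general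
`t` it coincides with the curve of fixed points (`mem_fixedCurve`, `fixedCurve_subset`).

A rotation that conjugates two half-turns carries the fixed points of one to those of the other,
which gives one direction (`realBirational_of_isConj`). Conversely, a birational map over the base
between the curves of fixed points of the half-turns by `a` and `b` embeds `ℝ(t)(√b²)` into
`ℝ(t)(√a²)`. Neither `a²` nor `b²` is a square, because the norm of `H` is anisotropic (the conic
has no real points for `t > 1`, see `eq_zero_of_qnorm`), so `a²` and `b²` differ by the square of a
rational function (`exists_qdisc_mul_sq`). After rescaling `a² = b²`, and then
`(a + b) a = b (a + b)` shows that the half-turns are conjugate (`isConj_of_qdisc`).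
-/

namespace RealSphere

open Polynomial
open scoped LinearAlgebra.Projectivization


/-! ### The quaternion algebra of the conic over the function field of the base -/

/-- The quaternion algebra `(-1, 1 - t²)` over `ℝ[t]`: a quaternion is written
`(a₁ + a₂ i) + (b₁ + b₂ i) j`, where `i² = -1` and `j² = 1 - t²`. -/
abbrev Quat : Type := QuaternionAlgebra ℝ[X] (-1) 0 (1 - X ^ 2)

/-- The reduced norm. It takes its values in the center, and is recorded as a polynomial. -/
noncomputable def qnorm (h : Quat) : ℝ[X] :=
  h.re ^ 2 + h.imI ^ 2 - (1 - X ^ 2) * (h.imJ ^ 2 + h.imK ^ 2)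

theorem mul_star_eq (h : Quat) : h * star h = ((qnorm h : ℝ[X]) : Quat) := by
  ext1 <;> simp only [QuaternionAlgebra.re_coe, QuaternionAlgebra.imI_coe,
    QuaternionAlgebra.imJ_coe, QuaternionAlgebra.imK_coe] <;> simp [qnorm] <;> ring

theorem star_mul_eq (h : Quat) : star h * h = ((qnorm h : ℝ[X]) : Quat) := by
  ext1 <;> simp only [QuaternionAlgebra.re_coe, QuaternionAlgebra.imI_coe,
    QuaternionAlgebra.imJ_coe, QuaternionAlgebra.imK_coe] <;> simp [qnorm] <;> ring

theorem qnorm_mul (h k : Quat) : qnorm (h * k) = qnorm h * qnorm k := by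
  simp [qnorm]; ring

theorem qnorm_star (h : Quat) : qnorm (star h) = qnorm h := by
  simp [qnorm]

theorem one_sub_sq_ne_zero : (1 - X ^ 2 : ℝ[X]) ≠ 0 := fun h => by
  have := congrArg (eval 0) h
  simp at this

theorem eq_zero_of_eval_gt_one {p : ℝ[X]} (h : ∀ t : ℝ, 1 < t → p.eval t = 0) : p = 0 :=
  Polynomial.eq_zero_of_infinite_isRoot p ((Set.Ioi_infinite (1 : ℝ)).mono h)

/-- The norm is anisotropic, because it is positive definite at the real `t > 1`, where the conic
has no real points. -/
theorem eq_zero_of_qnorm {h : Quat} (h0 : qnorm h = 0) : h = 0 := by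
  have key : ∀ t : ℝ, 1 < t → h.re.eval t = 0 ∧ h.imI.eval t = 0 ∧ h.imJ.eval t = 0 ∧
      h.imK.eval t = 0 := by
    intro t ht
    have h1 := congrArg (eval t) h0
    simp only [qnorm, eval_sub, eval_add, eval_mul, eval_pow, eval_one, eval_X, eval_zero] at h1
    have hd : 0 < t ^ 2 - 1 := by nlinarith
    have p1 := sq_nonneg (h.re.eval t)
    have p2 := sq_nonneg (h.imI.eval t)
    have p3 := mul_nonneg hd.le (sq_nonneg (h.imJ.eval t))
    have p4 := mul_nonneg hd.le (sq_nonneg (h.imK.eval t))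
    refine ⟨pow_eq_zero_iff two_ne_zero |>.1 (by linarith),
      pow_eq_zero_iff two_ne_zero |>.1 (by linarith), ?_, ?_⟩
    · have : (t ^ 2 - 1) * (h.imJ.eval t) ^ 2 = 0 := by linarith
      exact pow_eq_zero_iff two_ne_zero |>.1 ((mul_eq_zero.1 this).resolve_left hd.ne')
    · have : (t ^ 2 - 1) * (h.imK.eval t) ^ 2 = 0 := by linarith
      exact pow_eq_zero_iff two_ne_zero |>.1 ((mul_eq_zero.1 this).resolve_left hd.ne')
  ext1
  · exact eq_zero_of_eval_gt_one fun t ht => (key t ht).1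
  · exact eq_zero_of_eval_gt_one fun t ht => (key t ht).2.1
  · exact eq_zero_of_eval_gt_one fun t ht => (key t ht).2.2.1
  · exact eq_zero_of_eval_gt_one fun t ht => (key t ht).2.2.2

theorem qnorm_ne_zero {h : Quat} (h0 : h ≠ 0) : qnorm h ≠ 0 := fun h1 => h0 (eq_zero_of_qnorm h1)

theorem quat_mul_ne_zero {h k : Quat} (hh : h ≠ 0) (hk : k ≠ 0) : h * k ≠ 0 := by
  intro h0
  have := qnorm_mul h k
  rw [h0] at this
  exact mul_ne_zero (qnorm_ne_zero hh) (qnorm_ne_zero hk) (by rw [← this]; simp [qnorm])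

theorem star_ne_zero' {h : Quat} (h0 : h ≠ 0) : star h ≠ 0 := by
  intro h1
  apply qnorm_ne_zero h0
  rw [← qnorm_star, h1]
  simp [qnorm]

theorem coe_quat_ne_zero {c : ℝ[X]} (hc : c ≠ 0) : (c : Quat) ≠ 0 := by
  intro h
  exact hc (congrArg QuaternionAlgebra.re h)

/-- The action of a quaternion on the conic `x² + y² = (1 - t²) w²`, in the coordinates `w, x, y`.
In the parametrization `w = uv`, `x + iy = (1 - t²) u²`, `x - iy = v²` of the conic, the quaternion
`a + b j` acts by `(u : v) ↦ (a u + b v : (1 - t²) b̄ u + ā v)`. -/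
noncomputable def rotMatrix (h : Quat) : Matrix (Fin 3) (Fin 3) ℝ[X] :=
  !![h.re ^ 2 + h.imI ^ 2 + (1 - X ^ 2) * (h.imJ ^ 2 + h.imK ^ 2),
      2 * (h.re * h.imJ + h.imI * h.imK), -2 * (h.imI * h.imJ - h.re * h.imK);
    2 * (1 - X ^ 2) * (h.re * h.imJ - h.imI * h.imK),
      (1 - X ^ 2) * (h.imJ ^ 2 - h.imK ^ 2) + (h.re ^ 2 - h.imI ^ 2),
      2 * (1 - X ^ 2) * (h.imJ * h.imK) - 2 * (h.re * h.imI);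
    2 * (1 - X ^ 2) * (h.re * h.imK + h.imI * h.imJ),
      2 * (1 - X ^ 2) * (h.imJ * h.imK) + 2 * (h.re * h.imI),
      (h.re ^ 2 - h.imI ^ 2) - (1 - X ^ 2) * (h.imJ ^ 2 - h.imK ^ 2)]

theorem rotMatrix_mul (h k : Quat) : rotMatrix (h * k) = rotMatrix h * rotMatrix k := by
  ext1 i j
  fin_cases i <;> fin_cases j <;>
    simp [rotMatrix, Matrix.mul_apply, Fin.sum_univ_three] <;> ring

theorem rotMatrix_coe (c : ℝ[X]) :
    rotMatrix (c : Quat) = c ^ 2 • (1 : Matrix (Fin 3) (Fin 3) ℝ[X]) := by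
  ext1 i j
  fin_cases i <;> fin_cases j <;> simp [rotMatrix]

/-! ### Rotations of the conic bundle -/

/-- The action of the quaternion `h` on the plane `z = t w` of `ℙ³`, in homogeneous coordinates. -/
noncomputable def act (h : Quat) (t : ℂ) (v : Fin 4 → ℂ) : Fin 4 → ℂ :=
  let r := (rotMatrix h).map (aeval t : ℝ[X] → ℂ) |>.mulVec ![v 0, v 1, v 2]
  ![r 0, r 1, r 2, t * r 0]

theorem act_three (h : Quat) (t : ℂ) (v : Fin 4 → ℂ) : act h t v 3 = t * act h t v 0 := rfl

theorem act_mul (h k : Quat) (t : ℂ) (v : Fin 4 → ℂ) :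
    act (h * k) t v = act h t (act k t v) := by
  have e : (rotMatrix (h * k)).map (aeval t : ℝ[X] → ℂ)
      = (rotMatrix h).map (aeval t : ℝ[X] → ℂ) * (rotMatrix k).map (aeval t : ℝ[X] → ℂ) := by
    rw [rotMatrix_mul]
    exact Matrix.map_mul
  have e2 : ∀ w : Fin 3 → ℂ, ![w 0, w 1, w 2] = w := by
    intro w; ext i; fin_cases i <;> rfl
  simp only [act, e, ← Matrix.mulVec_mulVec]
  simp only [Matrix.cons_val_zero, Matrix.cons_val_one, Matrix.cons_val, e2]

theorem act_smul (h : Quat) (t c : ℂ) (v : Fin 4 → ℂ) : act h t (c • v) = c • act h t v := by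
  have e : ![(c • v) 0, (c • v) 1, (c • v) 2] = c • ![v 0, v 1, v 2] := by
    simp [Pi.smul_apply]
  simp only [act, e, Matrix.mulVec_smul]
  ext i; fin_cases i <;> simp [Pi.smul_apply]; ring

theorem act_coe (c : ℝ[X]) {t : ℂ} {v : Fin 4 → ℂ} (hv : v 3 = t * v 0) :
    act (c : Quat) t v = (aeval t c) ^ 2 • v := by
  ext i
  fin_cases i <;> simp [act, rotMatrix_coe, Matrix.mulVec, dotProduct, Fin.sum_univ_three, hv]
  ring

theorem act_zero_eq (h : Quat) (t : ℂ) (v : Fin 4 → ℂ) : act h t v 0 =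
    (aeval t h.re ^ 2 + aeval t h.imI ^ 2 + (1 - t ^ 2) * (aeval t h.imJ ^ 2 + aeval t h.imK ^ 2))
      * v 0 + 2 * (aeval t h.re * aeval t h.imJ + aeval t h.imI * aeval t h.imK) * v 1
      - 2 * (aeval t h.imI * aeval t h.imJ - aeval t h.re * aeval t h.imK) * v 2 := by
  simp [act, rotMatrix, Matrix.mulVec, dotProduct, Fin.sum_univ_three, map_ofNat]
  ring

theorem act_one_eq (h : Quat) (t : ℂ) (v : Fin 4 → ℂ) : act h t v 1 =
    2 * (1 - t ^ 2) * (aeval t h.re * aeval t h.imJ - aeval t h.imI * aeval t h.imK) * v 0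
      + ((1 - t ^ 2) * (aeval t h.imJ ^ 2 - aeval t h.imK ^ 2)
        + (aeval t h.re ^ 2 - aeval t h.imI ^ 2)) * v 1
      + (2 * (1 - t ^ 2) * (aeval t h.imJ * aeval t h.imK)
        - 2 * (aeval t h.re * aeval t h.imI)) * v 2 := by
  simp [act, rotMatrix, Matrix.mulVec, dotProduct, Fin.sum_univ_three, map_ofNat]

theorem act_two_eq (h : Quat) (t : ℂ) (v : Fin 4 → ℂ) : act h t v 2 =
    2 * (1 - t ^ 2) * (aeval t h.re * aeval t h.imK + aeval t h.imI * aeval t h.imJ) * v 0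
      + (2 * (1 - t ^ 2) * (aeval t h.imJ * aeval t h.imK)
        + 2 * (aeval t h.re * aeval t h.imI)) * v 1
      + ((aeval t h.re ^ 2 - aeval t h.imI ^ 2)
        - (1 - t ^ 2) * (aeval t h.imJ ^ 2 - aeval t h.imK ^ 2)) * v 2 := by
  simp [act, rotMatrix, Matrix.mulVec, dotProduct, Fin.sum_univ_three, map_ofNat]

theorem mem_cone_iff {t : ℂ} {v : Fin 4 → ℂ} (hv : v 3 = t * v 0) :
    v ∈ cone ↔ v 1 ^ 2 + v 2 ^ 2 = (1 - t ^ 2) * v 0 ^ 2 := by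
  simp only [cone, Set.mem_ofPred_eq, hv]
  constructor <;> intro h <;> linear_combination -h

theorem act_mem_cone (h : Quat) {t : ℂ} {v : Fin 4 → ℂ} (hv : v 3 = t * v 0) (hc : v ∈ cone) :
    act h t v ∈ cone := by
  rw [mem_cone_iff (act_three h t v), act_zero_eq, act_one_eq, act_two_eq]
  rw [mem_cone_iff hv] at hc
  linear_combination (aeval t h.re ^ 2 + aeval t h.imI ^ 2
    - (1 - t ^ 2) * (aeval t h.imJ ^ 2 + aeval t h.imK ^ 2)) ^ 2 * hc

/-- A rotation is inverted, up to a scalar, by the rotation by the conjugate quaternion. -/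
theorem act_star (h : Quat) {t : ℂ} {v : Fin 4 → ℂ} (hv : v 3 = t * v 0) :
    act h t (act (star h) t v) = (aeval t (qnorm h)) ^ 2 • v := by
  rw [← act_mul, mul_star_eq, act_coe _ hv]

theorem star_act (h : Quat) {t : ℂ} {v : Fin 4 → ℂ} (hv : v 3 = t * v 0) :
    act (star h) t (act h t v) = (aeval t (qnorm h)) ^ 2 • v := by
  rw [← act_mul, star_mul_eq, act_coe _ hv]

theorem act_zero_vec (h : Quat) (t : ℂ) : act h t 0 = 0 := by
  simpa using act_smul h t 0 0

theorem act_ne_zero (h : Quat) {t : ℂ} {v : Fin 4 → ℂ} (hv : v 3 = t * v 0)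
    (ht : aeval t (qnorm h) ≠ 0) (hv0 : v ≠ 0) : act h t v ≠ 0 := by
  intro h0
  have := star_act h hv
  rw [h0, act_zero_vec] at this
  exact smul_ne_zero (pow_ne_zero 2 ht) hv0 this.symm

/-! ### Rotations as birational maps of the sphere -/

/-- The homogenization, of degree `n`, of a polynomial in `t = z / w`. -/
noncomputable def homForm (n : ℕ) (p : ℝ[X]) : MvPolynomial (Fin 4) ℝ :=
  ∑ k ∈ Finset.range (n + 1),
    MvPolynomial.C (p.coeff k) * (MvPolynomial.X 3 ^ k * MvPolynomial.X 0 ^ (n - k))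

theorem homForm_isHomogeneous (n : ℕ) (p : ℝ[X]) : (homForm n p).IsHomogeneous n := by
  refine MvPolynomial.IsHomogeneous.sum _ _ _ fun k hk => ?_
  have hk' : k ≤ n := Nat.lt_succ_iff.1 (Finset.mem_range.1 hk)
  have := ((MvPolynomial.isHomogeneous_X_pow (R := ℝ) (3 : Fin 4) k).mul
    (MvPolynomial.isHomogeneous_X_pow (R := ℝ) (0 : Fin 4) (n - k)))
  rw [Nat.add_sub_cancel' hk'] at this
  exact this.C_mul _

theorem aeval_homForm {n : ℕ} {p : ℝ[X]} (hp : p.natDegree ≤ n) {t : ℂ} {v : Fin 4 → ℂ}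
    (hv : v 3 = t * v 0) : MvPolynomial.aeval v (homForm n p) = v 0 ^ n * aeval t p := by
  rw [Polynomial.aeval_eq_sum_range' (Nat.lt_succ_of_le hp), homForm, map_sum, Finset.mul_sum]
  refine Finset.sum_congr rfl fun k hk => ?_
  have hk' : k ≤ n := Nat.lt_succ_iff.1 (Finset.mem_range.1 hk)
  simp only [map_mul, map_pow, MvPolynomial.aeval_X, MvPolynomial.aeval_C, hv, Algebra.smul_def]
  rw [show v 0 ^ n = v 0 ^ k * v 0 ^ (n - k) by rw [← pow_add, Nat.add_sub_cancel' hk']]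
  ring

/-- A bound for the degrees of the entries of the matrix of a rotation. -/
noncomputable def rotDeg (h : Quat) : ℕ := ∑ i, ∑ j, (rotMatrix h i j).natDegree

theorem natDegree_le_rotDeg (h : Quat) (i j : Fin 3) : (rotMatrix h i j).natDegree ≤ rotDeg h :=
  (Finset.single_le_sum (f := fun j => (rotMatrix h i j).natDegree) (fun _ _ => Nat.zero_le _)
    (Finset.mem_univ j)).trans (Finset.single_le_sum
      (f := fun i => ∑ j, (rotMatrix h i j).natDegree) (fun _ _ => Nat.zero_le _)
      (Finset.mem_univ i))

/-- The rows of the matrix of a rotation as forms on `ℙ³`. -/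
noncomputable def rotRow (h : Quat) (i : Fin 3) : MvPolynomial (Fin 4) ℝ :=
  ∑ j : Fin 3, homForm (rotDeg h) (rotMatrix h i j) * MvPolynomial.X j.castSucc

theorem rotRow_isHomogeneous (h : Quat) (i : Fin 3) :
    (rotRow h i).IsHomogeneous (rotDeg h + 1) :=
  MvPolynomial.IsHomogeneous.sum _ _ _ fun _ _ =>
    (homForm_isHomogeneous _ _).mul (MvPolynomial.isHomogeneous_X _ _)

theorem aeval_rotRow (h : Quat) (i : Fin 3) {t : ℂ} {v : Fin 4 → ℂ} (hv : v 3 = t * v 0) :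
    MvPolynomial.aeval v (rotRow h i) = v 0 ^ rotDeg h * act h t v i.castSucc := by
  simp only [rotRow, map_sum, map_mul, MvPolynomial.aeval_X,
    aeval_homForm (natDegree_le_rotDeg h i _) hv]
  fin_cases i <;> simp [act, Matrix.mulVec, dotProduct, Fin.sum_univ_three] <;> ring

/-- The forms of the rotation of the conic bundle by a quaternion. -/
noncomputable def rotForms (h : Quat) : Fin 4 → MvPolynomial (Fin 4) ℝ :=
  ![MvPolynomial.X 0 * rotRow h 0, MvPolynomial.X 0 * rotRow h 1, MvPolynomial.X 0 * rotRow h 2,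
    MvPolynomial.X 3 * rotRow h 0]

theorem ev_rotForms (h : Quat) {t : ℂ} {v : Fin 4 → ℂ} (hv : v 3 = t * v 0) :
    ev (rotForms h) v = v 0 ^ (rotDeg h + 1) • act h t v := by
  ext i
  fin_cases i
  · simp [ev, rotForms, aeval_rotRow h _ hv]; ring
  · simp [ev, rotForms, aeval_rotRow h _ hv]; ring
  · simp [ev, rotForms, aeval_rotRow h _ hv]; ring
  · simp [ev, rotForms, aeval_rotRow h _ hv, hv, act_three]; ring

/-- A form that vanishes on a nonempty Zariski open subset of the sphere vanishes on the sphere. -/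
theorem eq_zero_on_cone {f g : MvPolynomial (Fin 4) ℝ}
    (hg : ¬ ∀ v ∈ cone, MvPolynomial.aeval v g = 0)
    (h : ∀ v ∈ cone, MvPolynomial.aeval v g ≠ 0 → MvPolynomial.aeval v f = 0) :
    ∀ v ∈ cone, MvPolynomial.aeval v f = 0 := by
  refine (vanish_of_mul (f := f) (g := g) fun v hv => ?_).resolve_right hg
  by_cases h0 : MvPolynomial.aeval v g = 0
  · rw [h0, mul_zero]
  · rw [h v hv h0, zero_mul]

theorem mul_not_vanish {f g : MvPolynomial (Fin 4) ℝ}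
    (hf : ¬ ∀ v ∈ cone, MvPolynomial.aeval v f = 0)
    (hg : ¬ ∀ v ∈ cone, MvPolynomial.aeval v g = 0) :
    ¬ ∀ v ∈ cone, MvPolynomial.aeval v (f * g) = 0 := by
  intro h
  rcases vanish_of_mul (f := f) (g := g) (fun v hv => by rw [← map_mul]; exact h v hv) with h | h
  · exact hf h
  · exact hg h

/-- Rational maps that agree on a nonempty Zariski open subset of the sphere are equal. -/
theorem same_of_ne {F G : DomRep} {g : MvPolynomial (Fin 4) ℝ}
    (hg : ¬ ∀ v ∈ cone, MvPolynomial.aeval v g = 0)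
    (h : ∀ v ∈ cone, MvPolynomial.aeval v g ≠ 0 →
      ∀ i j, ev F.forms v i * ev G.forms v j = ev F.forms v j * ev G.forms v i) :
    DomRep.Same F G := by
  intro v hv i j
  have := eq_zero_on_cone (f := F.forms i * G.forms j - F.forms j * G.forms i) hg
    (fun v hv h0 => by
      rw [map_sub, map_mul, map_mul]
      exact sub_eq_zero.2 (h v hv h0 i j)) v hv
  rw [map_sub, map_mul, map_mul] at this
  exact sub_eq_zero.1 this

/-- A point of the conic over `t` with first coordinate one. -/
theorem exists_point (t : ℂ) : ∃ x : ℂ, ∀ e : ℂ, e ^ 2 = 1 → ![1, e * x, 0, t] ∈ cone := by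
  obtain ⟨x, hx⟩ := IsAlgClosed.exists_pow_nat_eq (1 - t ^ 2) (n := 2) (by norm_num)
  refine ⟨x, fun e he => ?_⟩
  simp [cone, mul_pow, he, hx]

theorem exists_aeval_ne_zero {p : ℝ[X]} (hp : p ≠ 0) : ∃ t : ℂ, aeval t p ≠ 0 := by
  by_contra! h
  apply hp
  have h1 : p.map (algebraMap ℝ ℂ) = 0 := Polynomial.funext fun t => by
    rw [eval_map_algebraMap, h t, eval_zero]
  exact (Polynomial.map_eq_zero _).1 h1

theorem homForm_not_vanish {n : ℕ} {p : ℝ[X]} (hp : p ≠ 0) (hn : p.natDegree ≤ n) :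
    ¬ ∀ v ∈ cone, MvPolynomial.aeval v (homForm n p) = 0 := by
  obtain ⟨t, ht⟩ := exists_aeval_ne_zero hp
  obtain ⟨x, hx⟩ := exists_point t
  intro h
  have h1 := h _ (hx 1 (by norm_num))
  rw [aeval_homForm hn (t := t) (by simp)] at h1
  simp at h1
  exact ht h1

/-- The upper left entry of the matrix of a rotation is positive definite at the `t` with
`-1 < t < 1`. -/
theorem rotMatrix_zero_zero_ne {h : Quat} (hh : h ≠ 0) : rotMatrix h 0 0 ≠ 0 := by
  intro h0
  have h0' : h.re ^ 2 + h.imI ^ 2 + (1 - X ^ 2) * (h.imJ ^ 2 + h.imK ^ 2) = 0 := by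
    simpa [rotMatrix] using h0
  have inf : ∀ p : ℝ[X], (∀ t : ℝ, t ∈ Set.Ioo (0 : ℝ) 1 → p.eval t = 0) → p = 0 := fun p hp =>
    Polynomial.eq_zero_of_infinite_isRoot p ((Set.Ioo_infinite (zero_lt_one' ℝ)).mono hp)
  have key : ∀ t : ℝ, t ∈ Set.Ioo (0 : ℝ) 1 → h.re.eval t = 0 ∧ h.imI.eval t = 0 ∧
      h.imJ.eval t = 0 ∧ h.imK.eval t = 0 := by
    rintro t ⟨ht0, ht⟩
    have h1 := congrArg (eval t) h0'
    simp only [eval_sub, eval_add, eval_mul, eval_pow, eval_one, eval_X, eval_zero] at h1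
    have hd : 0 < 1 - t ^ 2 := by nlinarith
    have p1 := sq_nonneg (h.re.eval t)
    have p2 := sq_nonneg (h.imI.eval t)
    have p3 := mul_nonneg hd.le (sq_nonneg (h.imJ.eval t))
    have p4 := mul_nonneg hd.le (sq_nonneg (h.imK.eval t))
    refine ⟨pow_eq_zero_iff two_ne_zero |>.1 (by linarith),
      pow_eq_zero_iff two_ne_zero |>.1 (by linarith), ?_, ?_⟩
    · have : (1 - t ^ 2) * (h.imJ.eval t) ^ 2 = 0 := by linarith
      exact pow_eq_zero_iff two_ne_zero |>.1 ((mul_eq_zero.1 this).resolve_left hd.ne')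
    · have : (1 - t ^ 2) * (h.imK.eval t) ^ 2 = 0 := by linarith
      exact pow_eq_zero_iff two_ne_zero |>.1 ((mul_eq_zero.1 this).resolve_left hd.ne')
  apply hh
  ext1
  · exact inf _ fun t ht => (key t ht).1
  · exact inf _ fun t ht => (key t ht).2.1
  · exact inf _ fun t ht => (key t ht).2.2.1
  · exact inf _ fun t ht => (key t ht).2.2.2

theorem rotRow_not_vanish {h : Quat} (hh : h ≠ 0) :
    ¬ ∀ v ∈ cone, MvPolynomial.aeval v (rotRow h 0) = 0 := by
  obtain ⟨t, ht⟩ := exists_aeval_ne_zero (rotMatrix_zero_zero_ne hh)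
  obtain ⟨x, hx⟩ := exists_point t
  intro hv
  -- The two points of the conic differ by the sign of `x`, so that the entry is the mean value.
  have h1 := hv _ (hx 1 (by norm_num))
  have h2 := hv _ (hx (-1) (by norm_num))
  rw [aeval_rotRow h 0 (t := t) (by simp)] at h1 h2
  simp [act, Matrix.mulVec, dotProduct, Fin.sum_univ_three] at h1 h2
  exact ht (by linear_combination (h1 + h2) / 2)

theorem exists_slope {v : Fin 4 → ℂ} (h0 : v 0 ≠ 0) : ∃ t : ℂ, v 3 = t * v 0 :=
  ⟨v 3 / v 0, by field_simp⟩

/-- The rotation by a nonzero quaternion, as a dominant rational map. -/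
noncomputable def rotRep (h : Quat) (hh : h ≠ 0) : DomRep where
  forms := rotForms h
  deg := 1 + (rotDeg h + 1)
  homog i := by
    fin_cases i <;> exact (MvPolynomial.isHomogeneous_X _ _).mul (rotRow_isHomogeneous h _)
  mapsTo := by
    have key := eq_zero_on_cone (f := rotForms h 0 ^ 2 - rotForms h 1 ^ 2 - rotForms h 2 ^ 2
      - rotForms h 3 ^ 2) X_zero_ne (fun v hv h0 => by
        rw [MvPolynomial.aeval_X] at h0
        obtain ⟨t, ht⟩ := exists_slope h0
        have h1 : ∀ i, MvPolynomial.aeval v (rotForms h i)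
          = v 0 ^ (rotDeg h + 1) * act h t v i := fun i => congrFun (ev_rotForms h ht) i
        have h2 : act h t v 0 ^ 2 = act h t v 1 ^ 2 + act h t v 2 ^ 2 + act h t v 3 ^ 2 :=
          act_mem_cone h ht hv
        simp only [map_sub, map_pow, h1]
        linear_combination (v 0 ^ (rotDeg h + 1)) ^ 2 * h2)
    intro v hv
    have := key v hv
    simp only [map_sub, map_pow] at this
    simp only [cone, Set.mem_ofPred_eq, ev]
    linear_combination this
  dominant := by
    intro f d hf hv
    refine eq_zero_on_cone (mul_not_vanish (mul_not_vanish X_zero_ne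
      (rotRow_not_vanish (star_ne_zero' hh)))
      (homForm_not_vanish (qnorm_ne_zero hh) le_rfl)) fun v hc h0 => ?_
    simp only [map_mul, MvPolynomial.aeval_X] at h0
    obtain ⟨h0, hN⟩ := mul_ne_zero_iff.1 h0
    obtain ⟨h0, hR⟩ := mul_ne_zero_iff.1 h0
    obtain ⟨t, ht⟩ := exists_slope h0
    rw [aeval_rotRow _ _ ht] at hR
    rw [aeval_homForm le_rfl ht] at hN
    have h1 := hv _ (act_mem_cone (star h) ht hc)
    rw [ev_rotForms h (act_three _ t v), act_star h ht, smul_smul] at h1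
    have h2 := congrFun (ev_smul (F := fun _ => f) (d := d) (fun _ => hf)
      (act (star h) t v 0 ^ (rotDeg h + 1) * aeval t (qnorm h) ^ 2) v) 0
    simp only [ev, Pi.smul_apply, smul_eq_mul] at h2
    rw [h1] at h2
    refine (mul_eq_zero.1 h2.symm).resolve_left (pow_ne_zero _ (mul_ne_zero (pow_ne_zero _ ?_)
      (pow_ne_zero _ (right_ne_zero_of_mul hN))))
    exact right_ne_zero_of_mul hR

theorem ev_rotRep {h : Quat} (hh : h ≠ 0) {t : ℂ} {v : Fin 4 → ℂ} (hv : v 3 = t * v 0) :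
    ev (rotRep h hh).forms v = v 0 ^ (rotDeg h + 1) • act h t v := ev_rotForms h hv

theorem rotRep_comp {h k : Quat} (hh : h ≠ 0) (hk : k ≠ 0) (hhk : h * k ≠ 0) :
    DomRep.Same (DomRep.comp (rotRep h hh) (rotRep k hk)) (rotRep (h * k) hhk) := by
  refine same_of_ne X_zero_ne fun v hv h0 i j => ?_
  rw [MvPolynomial.aeval_X] at h0
  obtain ⟨t, ht⟩ := exists_slope h0
  rw [DomRep.ev_comp, ev_rotRep hk ht, ev_rotRep hhk ht, ev_rotRep hh (t := t), act_smul,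
    act_mul]
  · simp only [Pi.smul_apply, smul_eq_mul]; ring
  · simp only [Pi.smul_apply, smul_eq_mul, act_three]; ring

theorem rotRep_coe {c : ℝ[X]} (hc : (c : Quat) ≠ 0) : DomRep.Same (rotRep c hc) DomRep.one := by
  refine same_of_ne X_zero_ne fun v hv h0 i j => ?_
  rw [MvPolynomial.aeval_X] at h0
  obtain ⟨t, ht⟩ := exists_slope h0
  rw [ev_rotRep hc ht, DomRep.ev_one, act_coe c ht]
  simp only [Pi.smul_apply, smul_eq_mul]; ring

/-- The rotation by a nonzero quaternion, as an element of the monoid of dominant rational maps. -/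
noncomputable def rotRat (h : Quat) (hh : h ≠ 0) : DomRat :=
  Quotient.mk DomRep.setoid (rotRep h hh)

theorem rotRat_mul {h k : Quat} (hh : h ≠ 0) (hk : k ≠ 0) :
    rotRat h hh * rotRat k hk = rotRat (h * k) (quat_mul_ne_zero hh hk) :=
  Quotient.sound (s := DomRep.setoid) (rotRep_comp hh hk (quat_mul_ne_zero hh hk))

theorem rotRat_eq_one {h : Quat} (hh : h ≠ 0) {c : ℝ[X]} (hc : h = c) : rotRat h hh = 1 := by
  subst hc
  exact Quotient.sound (s := DomRep.setoid) (rotRep_coe hh)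

/-- The rotation by a nonzero quaternion, as an element of `Bir(S/π)`. -/
noncomputable def rotBir (h : Quat) (hh : h ≠ 0) : BirOverBase where
  val :=
    { val := rotRat h hh
      inv := rotRat (star h) (star_ne_zero' hh)
      val_inv := by
        rw [rotRat_mul]; exact rotRat_eq_one _ (mul_star_eq h)
      inv_val := by
        rw [rotRat_mul]; exact rotRat_eq_one _ (star_mul_eq h) }
  property := by
    refine ⟨rotRep h hh, rfl, fun v _ => ?_⟩
    simp only [ev, rotRep, rotForms, Matrix.cons_val_zero, Matrix.cons_val, map_mul,
      MvPolynomial.aeval_X]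
    ring

theorem represents_rotBir {h : Quat} (hh : h ≠ 0) : Represents (rotRep h hh) (rotBir h hh).1 := rfl

theorem eq_of_represents {F G : DomRep} {A B : BirOverBase} (hF : Represents F A.1)
    (hG : Represents G B.1) (h : DomRep.Same F G) : A = B := by
  apply Subtype.ext
  apply Units.ext
  rw [← hF, ← hG]
  exact Quotient.sound h

theorem same_of_represents {F G : DomRep} {A : BirSphere} (hF : Represents F A)
    (hG : Represents G A) : DomRep.Same F G :=
  Quotient.exact (hF.trans hG.symm)

theorem rotBir_mul {h k : Quat} (hh : h ≠ 0) (hk : k ≠ 0) :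
    rotBir h hh * rotBir k hk = rotBir (h * k) (quat_mul_ne_zero hh hk) := by
  apply Subtype.ext
  apply Units.ext
  exact rotRat_mul hh hk

theorem rotBir_coe {c : ℝ[X]} (hc : (c : Quat) ≠ 0) : rotBir c hc = 1 := by
  apply Subtype.ext
  apply Units.ext
  exact rotRat_eq_one hc rfl

theorem rotBir_congr {h k : Quat} (hh : h ≠ 0) (hk : k ≠ 0) (e : h = k) :
    rotBir h hh = rotBir k hk := by subst e; rfl

theorem rotBir_coe_mul {c : ℝ[X]} {h : Quat} (hh : h ≠ 0) (hch : (c : Quat) * h ≠ 0) :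
    rotBir (c * h) hch = rotBir h hh := by
  have hc : (c : Quat) ≠ 0 := left_ne_zero_of_mul hch
  rw [← rotBir_mul hc hh, rotBir_coe, one_mul]

/-! ### Rotations in the parameters of the conic -/

theorem cone_mul_eq {t : ℂ} {v : Fin 4 → ℂ} (hv : v 3 = t * v 0) (hc : v ∈ cone) :
    (v 1 + Complex.I * v 2) * (v 1 - Complex.I * v 2) = (1 - t ^ 2) * v 0 ^ 2 := by
  rw [mem_cone_iff hv] at hc
  linear_combination hc - v 2 ^ 2 * Complex.I_sq

/-- The value at `(u : v) = (w : x - i y)` of the linear form `a u + b v` of a quaternion. -/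
noncomputable def linU (h : Quat) (t : ℂ) (v : Fin 4 → ℂ) : ℂ :=
  (aeval t h.re + Complex.I * aeval t h.imI) * v 0
    + (aeval t h.imJ + Complex.I * aeval t h.imK) * (v 1 - Complex.I * v 2)

/-- The value at `(u : v) = (w : x - i y)` of the linear form `(1 - t²) b̄ u + ā v` of a
quaternion. -/
noncomputable def linV (h : Quat) (t : ℂ) (v : Fin 4 → ℂ) : ℂ :=
  (1 - t ^ 2) * (aeval t h.imJ - Complex.I * aeval t h.imK) * v 0
    + (aeval t h.re - Complex.I * aeval t h.imI) * (v 1 - Complex.I * v 2)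

theorem act_zero_param (h : Quat) {t : ℂ} {v : Fin 4 → ℂ}
    (hq : (v 1 + Complex.I * v 2) * (v 1 - Complex.I * v 2) = (1 - t ^ 2) * v 0 ^ 2) :
    act h t v 0 * (v 1 - Complex.I * v 2) = linU h t v * linV h t v := by
  rw [act_zero_eq, linU, linV]
  have hI := Complex.I_sq
  generalize Complex.I = I at *
  grind

theorem act_sub_param (h : Quat) {t : ℂ} {v : Fin 4 → ℂ}
    (hq : (v 1 + Complex.I * v 2) * (v 1 - Complex.I * v 2) = (1 - t ^ 2) * v 0 ^ 2) :
    (act h t v 1 - Complex.I * act h t v 2) * (v 1 - Complex.I * v 2) = linV h t v ^ 2 := by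
  rw [act_one_eq, act_two_eq, linV]
  have hI := Complex.I_sq
  generalize Complex.I = I at *
  grind

theorem act_add_param (h : Quat) {t : ℂ} {v : Fin 4 → ℂ}
    (hq : (v 1 + Complex.I * v 2) * (v 1 - Complex.I * v 2) = (1 - t ^ 2) * v 0 ^ 2) :
    (act h t v 1 + Complex.I * act h t v 2) * (v 1 - Complex.I * v 2)
      = (1 - t ^ 2) * linU h t v ^ 2 := by
  rw [act_one_eq, act_two_eq, linU]
  have hI := Complex.I_sq
  generalize Complex.I = I at *
  grind

/-- The point of the conic over `t` with `w = s` and `x - i y = 1`. -/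
noncomputable def numPt (t s : ℂ) : Fin 4 → ℂ :=
  ![s, ((1 - t ^ 2) * s ^ 2 + 1) / 2, -(Complex.I / 2) * ((1 - t ^ 2) * s ^ 2 - 1), t * s]

theorem numPt_sub (t s : ℂ) : numPt t s 1 - Complex.I * numPt t s 2 = 1 := by
  simp only [numPt, Matrix.cons_val_one, Matrix.cons_val]
  linear_combination ((1 - t ^ 2) * s ^ 2 - 1) / 2 * Complex.I_sq

theorem numPt_add (t s : ℂ) :
    numPt t s 1 + Complex.I * numPt t s 2 = (1 - t ^ 2) * s ^ 2 := by
  simp only [numPt, Matrix.cons_val_one, Matrix.cons_val]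
  linear_combination -((1 - t ^ 2) * s ^ 2 - 1) / 2 * Complex.I_sq

theorem numPt_three (t s : ℂ) : numPt t s 3 = t * numPt t s 0 := rfl

theorem numPt_mem (t s : ℂ) : numPt t s ∈ cone := by
  rw [mem_cone_iff (numPt_three t s)]
  have h1 := numPt_sub t s
  have h2 := numPt_add t s
  have h3 : numPt t s 0 = s := rfl
  rw [h3]
  linear_combination numPt t s 2 ^ 2 * Complex.I_sq
    + (numPt t s 1 + Complex.I * numPt t s 2) * h1 + h2

theorem eq_smul_numPt {t : ℂ} {v : Fin 4 → ℂ} (hv : v 3 = t * v 0) (hc : v ∈ cone)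
    (h : v 1 - Complex.I * v 2 ≠ 0) :
    v = (v 1 - Complex.I * v 2) • numPt t (v 0 / (v 1 - Complex.I * v 2)) := by
  have hq := cone_mul_eq hv hc
  have h1 := numPt_sub t (v 0 / (v 1 - Complex.I * v 2))
  have h2 := numPt_add t (v 0 / (v 1 - Complex.I * v 2))
  have h3 : v 1 + Complex.I * v 2 = (v 1 - Complex.I * v 2)
      * ((1 - t ^ 2) * (v 0 / (v 1 - Complex.I * v 2)) ^ 2) := by
    field_simp
    linear_combination hq
  rw [← h2] at h3
  set V := v 1 - Complex.I * v 2 with hV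
  set p := numPt t (v 0 / V) with hp
  have e0 : v 0 = V * p 0 := by
    rw [hp]; simp only [numPt, Matrix.cons_val_zero]; field_simp
  have e1 : v 1 = V * p 1 := by linear_combination (h3 - V * h1 - hV) / 2
  have e2 : v 2 = V * p 2 := by
    linear_combination (-Complex.I / 2) * (h3 + V * h1 + hV) + (v 2 - V * p 2) * Complex.I_sq
  have e3 : v 3 = V * p 3 := by
    rw [hv, hp, numPt_three, ← hp, e0]; ring
  ext i; fin_cases i
  · exact e0
  · exact e1
  · exact e2
  · exact e3

/-! ### Elements of `Bir(S/π)` that are given by scalars -/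

/-- Only the scalars act trivially: a homography that fixes the parameter of every point is
scalar. -/
theorem im_eq_zero_of_rotBir_eq_one {h : Quat} (hh : h ≠ 0) (h1 : rotBir h hh = 1) :
    h.imI = 0 ∧ h.imJ = 0 ∧ h.imK = 0 := by
  have hs : DomRep.Same (rotRep h hh) DomRep.one := by
    refine same_of_represents (A := 1) ?_ rfl
    have := represents_rotBir hh
    rwa [h1] at this
  -- The homography of the parameters `s = u / v` fixes `s`.
  have quad : ∀ t s : ℂ, aeval t (qnorm h) ≠ 0 → 1 - t ^ 2 ≠ 0 → s ≠ 0 →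
      linU h t (numPt t s) = s * linV h t (numPt t s) := by
    intro t s hN hd hs0
    have hp := numPt_mem t s
    have hp3 := numPt_three t s
    have hq := cone_mul_eq hp3 hp
    have hp0 : numPt t s 0 = s := rfl
    have prop : ∀ i j, act h t (numPt t s) i * numPt t s j
        = act h t (numPt t s) j * numPt t s i := by
      intro i j
      have := hs _ hp i j
      rw [DomRep.ev_one, ev_rotRep hh hp3] at this
      simp only [Pi.smul_apply, smul_eq_mul, hp0] at this
      exact mul_left_cancel₀ (pow_ne_zero (rotDeg h + 1) hs0) (by linear_combination this)
    have z0 := act_zero_param h hq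
    have z1 := act_sub_param h hq
    have z2 := act_add_param h hq
    rw [numPt_sub, mul_one] at z0 z1 z2
    have p1 := prop 0 1
    have p2 := prop 0 2
    have ha := numPt_sub t s
    have hb := numPt_add t s
    rw [hp0] at p1 p2
    have q1 : act h t (numPt t s) 0 = (act h t (numPt t s) 1
        - Complex.I * act h t (numPt t s) 2) * s := by
      linear_combination p1 - Complex.I * p2 - act h t (numPt t s) 0 * ha
    have q2 : act h t (numPt t s) 0 * ((1 - t ^ 2) * s ^ 2) = (act h t (numPt t s) 1
        + Complex.I * act h t (numPt t s) 2) * s := by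
      linear_combination p1 + Complex.I * p2 - act h t (numPt t s) 0 * hb
    rw [z0, z1] at q1
    rw [z0, z2] at q2
    by_contra hne
    have hne' := sub_ne_zero.2 hne
    have hV : linV h t (numPt t s) = 0 := by
      have : linV h t (numPt t s) * (linU h t (numPt t s) - s * linV h t (numPt t s)) = 0 := by
        linear_combination q1
      exact (mul_eq_zero.1 this).resolve_right hne'
    have hU : linU h t (numPt t s) = 0 := by
      rw [hV] at q2
      have : (1 - t ^ 2) * s * linU h t (numPt t s) ^ 2 = 0 := by linear_combination -q2
      exact pow_eq_zero_iff two_ne_zero |>.1 ((mul_eq_zero.1 this).resolve_left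
        (mul_ne_zero hd hs0))
    rw [hU, hV] at z0
    rw [hV] at z1
    rw [hU] at z2
    refine act_ne_zero h hp3 hN (fun h0 => hs0 ?_) ?_
    · rw [← hp0, h0]; rfl
    · have e1 : act h t (numPt t s) 1 = 0 := by linear_combination (z1 + z2) / 2
      have e2 : act h t (numPt t s) 2 = 0 := by
        linear_combination (-Complex.I / 2) * (z2 - z1) + act h t (numPt t s) 2 * Complex.I_sq
      have e0 : act h t (numPt t s) 0 = 0 := by simpa using z0
      ext i; fin_cases i
      · exact e0
      · exact e1
      · exact e2
      · exact (act_three h t _).trans (by rw [e0, mul_zero]; rfl)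
  have key : ∀ t : ℂ, aeval t (qnorm h) ≠ 0 → 1 - t ^ 2 ≠ 0 →
      aeval t h.imI = 0 ∧ aeval t h.imJ = 0 ∧ aeval t h.imK = 0 := by
    intro t hN hd
    have hp0 : ∀ s, numPt t s 0 = s := fun _ => rfl
    have e1 := quad t 1 hN hd one_ne_zero
    have e2 := quad t (-1) hN hd (by norm_num)
    have e3 := quad t 2 hN hd (by norm_num)
    simp only [linU, linV, numPt_sub, hp0] at e1 e2 e3
    have hI := Complex.I_ne_zero
    have f1 : aeval t h.imI = 0 := by
      have : Complex.I * aeval t h.imI = 0 := by linear_combination (e1 - e2) / 4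
      exact (mul_eq_zero.1 this).resolve_left hI
    have f2 : aeval t h.imJ + Complex.I * aeval t h.imK = 0 := by
      rw [f1] at e1 e3
      linear_combination (4 / 3) * e1 - (1 / 3) * e3
    have f3 : aeval t h.imJ - Complex.I * aeval t h.imK = 0 := by
      rw [f1, f2] at e1
      have : (1 - t ^ 2) * (aeval t h.imJ - Complex.I * aeval t h.imK) = 0 := by
        linear_combination -e1
      exact (mul_eq_zero.1 this).resolve_left hd
    refine ⟨f1, by linear_combination (f2 + f3) / 2, ?_⟩
    have : Complex.I * aeval t h.imK = 0 := by linear_combination (f2 - f3) / 2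
    exact (mul_eq_zero.1 this).resolve_left hI
  have fin : ∀ p : ℝ[X], (∀ t : ℂ, aeval t (qnorm h) ≠ 0 → 1 - t ^ 2 ≠ 0 → aeval t p = 0) →
      p = 0 := by
    intro p hp
    by_contra h0
    obtain ⟨t, ht⟩ := exists_aeval_ne_zero (mul_ne_zero (mul_ne_zero (qnorm_ne_zero hh)
      one_sub_sq_ne_zero) h0)
    simp only [map_mul] at ht
    have h1 := mul_ne_zero_iff.1 ht
    have h2 := mul_ne_zero_iff.1 h1.1
    exact h1.2 (hp t h2.1 (by simpa using h2.2))
  exact ⟨fin _ fun t h1 h2 => (key t h1 h2).1, fin _ fun t h1 h2 => (key t h1 h2).2.1,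
    fin _ fun t h1 h2 => (key t h1 h2).2.2⟩

/-! ### The generic point of the conic bundle -/

/-- The generic point of the cone over the conic bundle, in the coordinates `t` (inner variable)
and `s = w / (x - i y)` (outer variable). -/
noncomputable def genPt : Fin 4 → ℂ[X][X] :=
  ![X, C (C (1 / 2)) * (C (1 - X ^ 2) * X ^ 2 + 1),
    C (C (-(Complex.I / 2))) * (C (1 - X ^ 2) * X ^ 2 - 1), C X * X]

theorem genPt_sub : genPt 1 - C (C Complex.I) * genPt 2 = 1 := by
  have h : (C (C Complex.I) * C (C (-(Complex.I / 2))) : ℂ[X][X]) = C (C (1 / 2)) := by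
    rw [← C_mul, ← C_mul]; congr 2; linear_combination (-1 / 2) * Complex.I_sq
  have h2 : (C (C (1 / 2)) + C (C (1 / 2)) : ℂ[X][X]) = 1 := by
    rw [← C_add, ← C_add]; norm_num
  simp only [genPt, Matrix.cons_val_one, Matrix.cons_val]
  linear_combination (-(C (1 - X ^ 2) * X ^ 2 - 1)) * h + h2

theorem genPt_add : genPt 1 + C (C Complex.I) * genPt 2 = C (1 - X ^ 2) * X ^ 2 := by
  have h : (C (C Complex.I) * C (C (-(Complex.I / 2))) : ℂ[X][X]) = C (C (1 / 2)) := by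
    rw [← C_mul, ← C_mul]; congr 2; linear_combination (-1 / 2) * Complex.I_sq
  have h2 : (C (C (1 / 2)) + C (C (1 / 2)) : ℂ[X][X]) = 1 := by
    rw [← C_add, ← C_add]; norm_num
  simp only [genPt, Matrix.cons_val_one, Matrix.cons_val]
  linear_combination ((C (1 - X ^ 2) * X ^ 2 - 1)) * h + (C (1 - X ^ 2) * X ^ 2) * h2

theorem evalEval_genPt (t s : ℂ) (i : Fin 4) : (genPt i).evalEval t s = numPt t s i := by
  fin_cases i <;> simp [genPt, numPt, evalEval] <;> ring

theorem evalEval_aeval_genPt (t s : ℂ) (f : MvPolynomial (Fin 4) ℝ) :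
    (MvPolynomial.aeval genPt f).evalEval t s = MvPolynomial.aeval (numPt t s) f := by
  induction f using MvPolynomial.induction_on with
  | C r =>
    simp [Polynomial.algebraMap_apply, evalEval]
  | add p q hp hq => simp only [map_add, evalEval_add, hp, hq]
  | mul_X p i hp =>
    simp only [map_mul, evalEval_mul, hp, MvPolynomial.aeval_X, evalEval_genPt]

theorem eq_zero_of_evalEval {p : ℂ[X][X]} (h : ∀ t s, p.evalEval t s = 0) : p = 0 := by
  refine Polynomial.eq_zero_of_infinite_isRoot p
    ((Set.infinite_range_of_injective (C_injective (R := ℂ))).mono ?_)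
  rintro _ ⟨s, rfl⟩
  exact Polynomial.funext fun t => by rw [eval_zero]; exact h t s

theorem aeval_genPt_eq_zero {f : MvPolynomial (Fin 4) ℝ}
    (h : ∀ v ∈ cone, MvPolynomial.aeval v f = 0) : MvPolynomial.aeval genPt f = 0 :=
  eq_zero_of_evalEval fun t s => by rw [evalEval_aeval_genPt]; exact h _ (numPt_mem t s)

theorem norm_form_not_vanish : ¬ ∀ v ∈ cone, MvPolynomial.aeval v
    (MvPolynomial.X 0 ^ 2 - MvPolynomial.X 3 ^ 2 : MvPolynomial (Fin 4) ℝ) = 0 := by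
  intro h
  have := h ![1, 1, 0, 0] (by simp [cone])
  simp at this

theorem exists_slope_of_norm_ne_zero {v : Fin 4 → ℂ} (hc : v ∈ cone)
    (h0 : MvPolynomial.aeval v (MvPolynomial.X 0 * (MvPolynomial.X 0 ^ 2 - MvPolynomial.X 3 ^ 2) :
      MvPolynomial (Fin 4) ℝ) ≠ 0) :
    ∃ t, v 3 = t * v 0 ∧ v 0 ≠ 0 ∧ 1 - t ^ 2 ≠ 0 ∧ v 1 + Complex.I * v 2 ≠ 0 ∧
      v 1 - Complex.I * v 2 ≠ 0 := by
  simp only [map_mul, map_sub, map_pow, MvPolynomial.aeval_X] at h0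
  obtain ⟨h0, hd⟩ := mul_ne_zero_iff.1 h0
  obtain ⟨t, ht⟩ := exists_slope h0
  have hq := cone_mul_eq ht hc
  have hd' : v 0 ^ 2 - v 3 ^ 2 = (1 - t ^ 2) * v 0 ^ 2 := by rw [ht]; ring
  rw [hd'] at hd
  have := hd
  rw [← hq] at this
  exact ⟨t, ht, h0, left_ne_zero_of_mul hd, left_ne_zero_of_mul this, right_ne_zero_of_mul this⟩

/-- The generic point is Zariski dense in the cone. -/
theorem vanish_of_aeval_genPt {f : MvPolynomial (Fin 4) ℝ} {d : ℕ} (hf : f.IsHomogeneous d)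
    (h : MvPolynomial.aeval genPt f = 0) : ∀ v ∈ cone, MvPolynomial.aeval v f = 0 := by
  refine eq_zero_on_cone (mul_not_vanish X_zero_ne norm_form_not_vanish) fun v hv h0 => ?_
  obtain ⟨t, ht, -, -, -, hV⟩ := exists_slope_of_norm_ne_zero hv h0
  have h1 := congrFun (ev_smul (F := fun _ => f) (d := d) (fun _ => hf)
    (v 1 - Complex.I * v 2) (numPt t (v 0 / (v 1 - Complex.I * v 2)))) 0
  rw [← eq_smul_numPt ht hv hV] at h1
  simp only [ev, Pi.smul_apply, ← evalEval_aeval_genPt, h, evalEval_zero, smul_zero] at h1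
  exact h1

/-! ### Rational functions that generate the field of rational functions -/

theorem eval₂_smul_of_isHomogeneous {σ R S : Type*} [CommRing R] [CommRing S] (r : R →+* S)
    {f : MvPolynomial σ R} {d : ℕ} (hf : f.IsHomogeneous d) (c : S) (x : σ → S) :
    f.eval₂ r (c • x) = c ^ d * f.eval₂ r x := by
  rw [MvPolynomial.eval₂_eq, MvPolynomial.eval₂_eq, Finset.mul_sum]
  refine Finset.sum_congr rfl fun m hm => ?_
  have hd : m.degree = d := by
    have := hf (MvPolynomial.mem_support_iff.1 hm)
    rwa [Finsupp.degree_eq_weight_one]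
  simp only [Pi.smul_apply, smul_eq_mul, mul_pow, Finset.prod_mul_distrib]
  rw [Finset.prod_pow_eq_pow_sum, show ∑ i ∈ m.support, m i = d from hd]
  ring

open scoped IntermediateField in
/-- A rational function that generates the field of rational functions is a quotient of
polynomials of degree at most one: the degree of the extension that it generates is the maximum of
the degrees of its numerator and denominator. -/
theorem exists_moebius {M : Type*} [Field M] (φ : RatFunc M) (h : RatFunc.X ∈ M⟮φ⟯) :
    ∃ α β γ κ : M, (γ ≠ 0 ∨ κ ≠ 0) ∧
      φ * algebraMap M[X] (RatFunc M) (C γ * X + C κ)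
        = algebraMap M[X] (RatFunc M) (C α * X + C β) := by
  have htop : M⟮φ⟯ = ⊤ := by
    rw [← top_le_iff, ← RatFunc.adjoin_X]
    exact IntermediateField.adjoin_simple_le_iff.2 h
  have hdeg := RatFunc.finrank_eq_max_natDegree φ
  rw [htop, IntermediateField.finrank_top] at hdeg
  have hn : φ.num.natDegree ≤ 1 := (le_max_left _ _).trans hdeg.ge
  have hd : φ.denom.natDegree ≤ 1 := (le_max_right _ _).trans hdeg.ge
  have en := Polynomial.eq_X_add_C_of_natDegree_le_one hn
  have ed := Polynomial.eq_X_add_C_of_natDegree_le_one hd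
  refine ⟨φ.num.coeff 1, φ.num.coeff 0, φ.denom.coeff 1, φ.denom.coeff 0, ?_, ?_⟩
  rotate_left
  · rw [← en, ← ed]
    have h0 : algebraMap M[X] (RatFunc M) φ.denom ≠ 0 := by
      simpa using φ.denom_ne_zero
    exact (div_eq_iff h0).1 (RatFunc.num_div_denom φ) |>.symm
  · by_contra! h0
    rw [h0.1, h0.2] at ed
    exact φ.denom_ne_zero (by simpa using ed)

/-- The field of rational functions in `t` over `ℂ`. -/
def BaseField : Type := FractionRing ℂ[X]

noncomputable instance : Field BaseField := inferInstanceAs (Field (FractionRing ℂ[X]))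

noncomputable instance : Algebra ℂ[X] BaseField :=
  inferInstanceAs (Algebra ℂ[X] (FractionRing ℂ[X]))

instance : IsFractionRing ℂ[X] BaseField :=
  inferInstanceAs (IsFractionRing ℂ[X] (FractionRing ℂ[X]))

/-- Polynomials in `t` as constants of the field of rational functions in `s`. -/
noncomputable def constHom : ℂ[X] →+* RatFunc BaseField :=
  (algebraMap BaseField (RatFunc BaseField)).comp (algebraMap ℂ[X] BaseField)

/-- Substitution of a rational function for `s`. -/
noncomputable def substHom (φ : RatFunc BaseField) : ℂ[X][X] →+* RatFunc BaseField :=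
  eval₂RingHom constHom φ

theorem substHom_C (φ : RatFunc BaseField) (c : ℂ[X]) : substHom φ (C c) = constHom c :=
  eval₂_C _ _

theorem substHom_X (φ : RatFunc BaseField) : substHom φ X = φ := eval₂_X _ _

open scoped IntermediateField in
theorem substHom_mem (φ : RatFunc BaseField) (p : ℂ[X][X]) : substHom φ p ∈ BaseField⟮φ⟯ := by
  induction p using Polynomial.induction_on' with
  | add p q hp hq => rw [map_add]; exact add_mem hp hq
  | monomial n a =>
    rw [← C_mul_X_pow_eq_monomial, map_mul, map_pow, substHom_C, substHom_X]
    exact mul_mem (IntermediateField.algebraMap_mem _ _)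
      (pow_mem (IntermediateField.mem_adjoin_simple_self _ _) _)

theorem substHom_ratFuncX (p : ℂ[X][X]) : substHom RatFunc.X p
    = algebraMap BaseField[X] (RatFunc BaseField) (p.map (algebraMap ℂ[X] BaseField)) := by
  induction p using Polynomial.induction_on' with
  | add p q hp hq => simp only [map_add, hp, hq, Polynomial.map_add]
  | monomial n a =>
    rw [← C_mul_X_pow_eq_monomial, map_mul, map_pow, substHom_C, substHom_X]
    simp [constHom, RatFunc.algebraMap_eq_C]

theorem substHom_ratFuncX_injective : Function.Injective (substHom RatFunc.X) := by
  intro p q h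
  rw [substHom_ratFuncX, substHom_ratFuncX] at h
  exact Polynomial.map_injective _ (IsFractionRing.injective ℂ[X] BaseField)
    (RatFunc.algebraMap_injective _ h)

/-- Real constants in the field of rational functions in `s`. -/
noncomputable def realHom : ℝ →+* RatFunc BaseField :=
  constHom.comp (C.comp (algebraMap ℝ ℂ))

theorem substHom_aeval (φ : RatFunc BaseField) (x : Fin 4 → ℂ[X][X])
    (f : MvPolynomial (Fin 4) ℝ) :
    substHom φ (MvPolynomial.aeval x f) = f.eval₂ realHom (fun i => substHom φ (x i)) := by
  induction f using MvPolynomial.induction_on with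
  | C r =>
    rw [MvPolynomial.aeval_C, MvPolynomial.eval₂_C,
      show algebraMap ℝ ℂ[X][X] r = C (C (algebraMap ℝ ℂ r)) from rfl, substHom_C]
    rfl
  | add p q hp hq => simp only [map_add, hp, hq, MvPolynomial.eval₂_add]
  | mul_X p i hp =>
    simp only [map_mul, hp, MvPolynomial.aeval_X, MvPolynomial.eval₂_mul, MvPolynomial.eval₂_X]

/-- Four rational functions in `t` have a common denominator `e`. -/
theorem exists_numerators (α β γ κ : BaseField) : ∃ (e a b c d : ℂ[X]), e ≠ 0 ∧
    algebraMap ℂ[X] BaseField a = algebraMap ℂ[X] BaseField e * α ∧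
    algebraMap ℂ[X] BaseField b = algebraMap ℂ[X] BaseField e * β ∧
    algebraMap ℂ[X] BaseField c = algebraMap ℂ[X] BaseField e * γ ∧
    algebraMap ℂ[X] BaseField d = algebraMap ℂ[X] BaseField e * κ := by
  obtain ⟨e, he⟩ := IsLocalization.exist_integer_multiples_of_finite (nonZeroDivisors ℂ[X])
    ![α, β, γ, κ]
  obtain ⟨a, ha⟩ := he 0
  obtain ⟨b, hb⟩ := he 1
  obtain ⟨c, hc⟩ := he 2
  obtain ⟨d, hd⟩ := he 3
  exact ⟨e, a, b, c, d, nonZeroDivisors.ne_zero e.2, by simpa [Algebra.smul_def] using ha,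
    by simpa [Algebra.smul_def] using hb, by simpa [Algebra.smul_def] using hc,
    by simpa [Algebra.smul_def] using hd⟩

theorem exists_real_imag (p : ℂ[X]) : ∃ q r : ℝ[X], ∀ t : ℂ,
    p.eval t = aeval t q + Complex.I * aeval t r := by
  induction p using Polynomial.induction_on' with
  | add p q hp hq =>
    obtain ⟨a, b, h⟩ := hp
    obtain ⟨c, d, h'⟩ := hq
    exact ⟨a + c, b + d, fun t => by rw [eval_add, h, h', map_add, map_add]; ring⟩
  | monomial n z =>
    refine ⟨monomial n z.re, monomial n z.im, fun t => ?_⟩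
    simp only [eval_monomial, aeval_monomial]
    conv_lhs => rw [← Complex.re_add_im z]
    simp only [Complex.coe_algebraMap]
    ring

/-! ### Every element of `Bir(S/π)` is a rotation -/

/-- The form that represents `x - i y` after a rational map, at the generic point. -/
noncomputable def genSub (F : DomRep) : ℂ[X][X] :=
  MvPolynomial.aeval genPt (F.forms 1) - C (C Complex.I) * MvPolynomial.aeval genPt (F.forms 2)

theorem DomRep.OverBase.genPt_three {F : DomRep} (hF : F.OverBase) :
    MvPolynomial.aeval genPt (F.forms 3) = C X * MvPolynomial.aeval genPt (F.forms 0) := by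
  have h := aeval_genPt_eq_zero (f := MvPolynomial.X 0 * F.forms 3 - MvPolynomial.X 3 * F.forms 0)
    (fun v hv => by
      rw [map_sub, map_mul, map_mul, MvPolynomial.aeval_X, MvPolynomial.aeval_X]
      exact sub_eq_zero.2 (hF v hv))
  rw [map_sub, map_mul, map_mul, MvPolynomial.aeval_X, MvPolynomial.aeval_X] at h
  have h0 : genPt 0 = X := rfl
  have h3 : genPt 3 = C X * X := rfl
  rw [h0, h3] at h
  exact mul_left_cancel₀ (X_ne_zero) (by linear_combination h)

theorem DomRep.OverBase.genSub_mul {F : DomRep} (hF : F.OverBase) :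
    (MvPolynomial.aeval genPt (F.forms 1) + C (C Complex.I) * MvPolynomial.aeval genPt (F.forms 2))
      * genSub F = C (1 - X ^ 2) * MvPolynomial.aeval genPt (F.forms 0) ^ 2 := by
  have h := aeval_genPt_eq_zero (f := F.forms 0 ^ 2 - F.forms 1 ^ 2 - F.forms 2 ^ 2
    - F.forms 3 ^ 2) (fun v hv => by
      have : ev F.forms v 0 ^ 2 = ev F.forms v 1 ^ 2 + ev F.forms v 2 ^ 2 + ev F.forms v 3 ^ 2 :=
        F.mapsTo v hv
      simp only [ev] at this
      simp only [map_sub, map_pow]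
      linear_combination this)
  simp only [map_sub, map_pow, hF.genPt_three] at h
  have hI : (C (C Complex.I) ^ 2 : ℂ[X][X]) = -1 := by
    rw [← C_pow, ← C_pow, Complex.I_sq]; simp
  have hd : (C (1 - X ^ 2) : ℂ[X][X]) = 1 - C X ^ 2 := by simp
  rw [genSub, hd]
  linear_combination -h - MvPolynomial.aeval genPt (F.forms 2) ^ 2 * hI

theorem DomRep.aeval_genPt_zero_ne (F : DomRep) : MvPolynomial.aeval genPt (F.forms 0) ≠ 0 :=
  fun h => F.zero_not_vanish (vanish_of_aeval_genPt (F.homog 0) h)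

theorem C_one_sub_ne_zero : (C (1 - X ^ 2) : ℂ[X][X]) ≠ 0 := by
  rw [Ne, C_eq_zero]
  intro h
  have := congrArg (eval 0) h
  simp at this

theorem DomRep.OverBase.genSub_ne_zero {F : DomRep} (hF : F.OverBase) : genSub F ≠ 0 := by
  intro h
  have := hF.genSub_mul
  rw [h, mul_zero] at this
  exact mul_ne_zero C_one_sub_ne_zero (pow_ne_zero 2 F.aeval_genPt_zero_ne) this.symm

/-- The rational function through which a rational map over the base acts on the parameter
`s = w / (x - i y)` of the generic conic. -/
noncomputable def parMap (F : DomRep) : RatFunc BaseField :=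
  substHom RatFunc.X (MvPolynomial.aeval genPt (F.forms 0)) / substHom RatFunc.X (genSub F)

theorem substHom_genSub_ne_zero {F : DomRep} (hF : F.OverBase) :
    substHom RatFunc.X (genSub F) ≠ 0 := fun h =>
  hF.genSub_ne_zero (substHom_ratFuncX_injective (by rw [h, map_zero]))

/-- The generic point is mapped to the point with parameter `parMap F`. -/
theorem substHom_forms {F : DomRep} (hF : F.OverBase) (i : Fin 4) :
    substHom RatFunc.X (MvPolynomial.aeval genPt (F.forms i))
      = substHom RatFunc.X (genSub F) * substHom (parMap F) (genPt i) := by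
  set g := substHom RatFunc.X (genSub F) with hg
  have hg0 : g ≠ 0 := substHom_genSub_ne_zero hF
  set f := fun i => substHom RatFunc.X (MvPolynomial.aeval genPt (F.forms i)) with hf
  change f i = _
  have hφ : g * parMap F = f 0 := by
    rw [parMap, ← hg]; exact mul_div_cancel₀ _ hg0
  have hsub : g = f 1 - constHom (C Complex.I) * f 2 := by
    rw [hg, genSub, map_sub, map_mul, substHom_C]
  have hmul : (f 1 + constHom (C Complex.I) * f 2) * g = constHom (1 - X ^ 2) * f 0 ^ 2 := by
    have := congrArg (substHom RatFunc.X) hF.genSub_mul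
    simpa only [map_mul, map_add, map_pow, substHom_C, ← hg] using this
  have h3 : f 3 = constHom X * f 0 := by
    have := congrArg (substHom RatFunc.X) hF.genPt_three
    simpa only [map_mul, substHom_C] using this
  have gsub : substHom (parMap F) (genPt 1)
      - constHom (C Complex.I) * substHom (parMap F) (genPt 2) = 1 := by
    have := congrArg (substHom (parMap F)) genPt_sub
    simpa only [map_mul, map_sub, map_one, substHom_C] using this
  have gadd : substHom (parMap F) (genPt 1)
      + constHom (C Complex.I) * substHom (parMap F) (genPt 2)
      = constHom (1 - X ^ 2) * parMap F ^ 2 := by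
    have := congrArg (substHom (parMap F)) genPt_add
    simpa only [map_mul, map_add, map_pow, substHom_C, substHom_X] using this
  have hI : constHom (C Complex.I) ^ 2 = -1 := by
    rw [← map_pow, ← C_pow, Complex.I_sq]; simp
  have two : (2 : RatFunc BaseField) ≠ 0 := by
    have hinj : Function.Injective constHom :=
      (algebraMap BaseField (RatFunc BaseField)).injective.comp
        (IsFractionRing.injective ℂ[X] BaseField)
    intro h
    rw [← map_ofNat constHom 2, map_eq_zero_iff _ hinj] at h
    exact two_ne_zero h
  -- The two isotropic coordinates of the image are proportional to those of the generic point.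
  have hadd : f 1 + constHom (C Complex.I) * f 2
      = g * (substHom (parMap F) (genPt 1)
        + constHom (C Complex.I) * substHom (parMap F) (genPt 2)) := by
    refine mul_right_cancel₀ hg0 ?_
    rw [hmul, gadd, ← hφ]; ring
  have hsub' : f 1 - constHom (C Complex.I) * f 2
      = g * (substHom (parMap F) (genPt 1)
        - constHom (C Complex.I) * substHom (parMap F) (genPt 2)) := by
    rw [gsub, mul_one, hsub]
  fin_cases i
  · change f 0 = g * substHom (parMap F) (genPt 0)
    rw [show genPt 0 = X from rfl, substHom_X, hφ]
  · change f 1 = g * substHom (parMap F) (genPt 1)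
    exact mul_left_cancel₀ two (by linear_combination hadd + hsub')
  · change f 2 = g * substHom (parMap F) (genPt 2)
    refine mul_left_cancel₀ two ?_
    linear_combination (-constHom (C Complex.I)) * (hadd - hsub')
      + (2 * (f 2 - g * substHom (parMap F) (genPt 2))) * hI
  · change f 3 = g * substHom (parMap F) (genPt 3)
    rw [show genPt 3 = C X * X from rfl, map_mul, substHom_X, substHom_C, h3, ← hφ]; ring

open scoped IntermediateField in
/-- If a rational map over the base has an inverse, then the parameter of the generic conic is a
rational function of its image. -/
theorem ratFuncX_mem_adjoin {F G : DomRep} (hF : F.OverBase)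
    (h : DomRep.Same (DomRep.comp G F) DomRep.one) :
    RatFunc.X ∈ BaseField⟮parMap F⟯ := by
  set q : Fin 4 → ℂ[X][X] := fun i => MvPolynomial.aeval genPt ((DomRep.comp G F).forms i) with hq
  have cross : ∀ i j, q i * genPt j = q j * genPt i := by
    intro i j
    have := aeval_genPt_eq_zero (f := (DomRep.comp G F).forms i * MvPolynomial.X j
      - (DomRep.comp G F).forms j * MvPolynomial.X i) (fun v hv => by
        have := h v hv i j
        rw [DomRep.ev_one] at this
        simp only [map_sub, map_mul, MvPolynomial.aeval_X]
        exact sub_eq_zero.2 this)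
    simp only [map_sub, map_mul, MvPolynomial.aeval_X] at this
    exact sub_eq_zero.1 this
  have key : ∀ i, substHom RatFunc.X (q i) = substHom RatFunc.X (genSub F) ^ G.deg
      * substHom (parMap F) (MvPolynomial.aeval genPt (G.forms i)) := by
    intro i
    have e : q i = MvPolynomial.aeval (fun j => MvPolynomial.aeval genPt (F.forms j))
        (G.forms i) := by
      simp only [hq, DomRep.comp, MvPolynomial.aeval_bind₁]
    rw [e, substHom_aeval, substHom_aeval, ← eval₂_smul_of_isHomogeneous _ (G.homog i)]
    congr 1
    funext j
    rw [substHom_forms hF j]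
    rfl
  have hX : (q 1 - C (C Complex.I) * q 2) * X = q 0 := by
    have h1 := cross 1 0
    have h2 := cross 2 0
    rw [show genPt 0 = X from rfl] at h1 h2
    linear_combination h1 - C (C Complex.I) * h2 + q 0 * genPt_sub
  have hq0 : substHom RatFunc.X (q 0) ≠ 0 := fun h0 =>
    (DomRep.comp G F).aeval_genPt_zero_ne (substHom_ratFuncX_injective (by rw [map_zero]; exact h0))
  have hX' := congrArg (substHom RatFunc.X) hX
  simp only [map_mul, map_sub, substHom_X, substHom_C, key] at hX'
  rw [key] at hq0
  have hg := left_ne_zero_of_mul hq0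
  have hX2 : substHom (parMap F) (genSub G) * RatFunc.X
      = substHom (parMap F) (MvPolynomial.aeval genPt (G.forms 0)) := by
    refine mul_left_cancel₀ hg ?_
    rw [← hX']
    simp only [genSub, map_sub, map_mul, substHom_C]
    ring
  have hne : substHom (parMap F) (genSub G) ≠ 0 := by
    intro h0
    rw [h0, zero_mul] at hX2
    exact hq0 (by rw [← hX2, mul_zero])
  rw [show RatFunc.X = substHom (parMap F) (MvPolynomial.aeval genPt (G.forms 0))
    / substHom (parMap F) (genSub G) by rw [← hX2]; field_simp]
  exact div_mem (substHom_mem _ _) (substHom_mem _ _)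

/-- A birational map over the base acts on the parameter of the conics by a homography. -/
theorem exists_homography {F G : DomRep} (hF : F.OverBase)
    (h : DomRep.Same (DomRep.comp G F) DomRep.one) :
    ∃ α β γ κ : ℂ[X], (γ ≠ 0 ∨ κ ≠ 0) ∧
      MvPolynomial.aeval genPt (F.forms 0) * (C γ * X + C κ) = (C α * X + C β) * genSub F := by
  obtain ⟨α', β', γ', κ', hne, hm⟩ := exists_moebius _ (ratFuncX_mem_adjoin hF h)
  obtain ⟨e, α, β, γ, κ, he, hα, hβ, hγ, hκ⟩ := exists_numerators α' β' γ' κ'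
  have he' : algebraMap ℂ[X] BaseField e ≠ 0 := fun h0 =>
    he (IsFractionRing.injective ℂ[X] BaseField (by rw [h0, map_zero]))
  refine ⟨α, β, γ, κ, ?_, ?_⟩
  · rcases hne with h0 | h0
    · left; rintro rfl; rw [map_zero] at hγ; exact mul_ne_zero he' h0 hγ.symm
    · right; rintro rfl; rw [map_zero] at hκ; exact mul_ne_zero he' h0 hκ.symm
  · apply substHom_ratFuncX_injective
    have hg := substHom_genSub_ne_zero hF
    have hφ : substHom RatFunc.X (MvPolynomial.aeval genPt (F.forms 0))
        = parMap F * substHom RatFunc.X (genSub F) := by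
      rw [parMap]; exact (div_mul_cancel₀ _ hg).symm
    simp only [map_mul, map_add, substHom_C, substHom_X, hφ]
    simp only [map_mul, map_add, RatFunc.algebraMap_X, RatFunc.algebraMap_C] at hm
    simp only [constHom, RingHom.comp_apply, hα, hβ, hγ, hκ, map_mul, RatFunc.algebraMap_eq_C]
    linear_combination (RatFunc.C (algebraMap ℂ[X] BaseField e))
      * substHom RatFunc.X (genSub F) * hm

theorem ev_conj (F : Fin 4 → MvPolynomial (Fin 4) ℝ) (v : Fin 4 → ℂ) (i : Fin 4) :
    ev F (fun j => starRingEnd ℂ (v j)) i = starRingEnd ℂ (ev F v i) := by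
  simp only [ev]
  generalize F i = f
  induction f using MvPolynomial.induction_on with
  | C r => simp
  | add p q hp hq => simp only [map_add, hp, hq]
  | mul_X p i hp => simp only [map_mul, hp, MvPolynomial.aeval_X]

theorem aeval_conj (p : ℝ[X]) (t : ℂ) :
    aeval (starRingEnd ℂ t) p = starRingEnd ℂ (aeval t p) := by
  induction p using Polynomial.induction_on' with
  | add p q hp hq => simp only [map_add, hp, hq]
  | monomial n a => simp [aeval_monomial]

theorem conj_mem_cone {v : Fin 4 → ℂ} (hv : v ∈ cone) :
    (fun j => starRingEnd ℂ (v j)) ∈ cone := by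
  have h : v 0 ^ 2 = v 1 ^ 2 + v 2 ^ 2 + v 3 ^ 2 := hv
  have := congrArg (starRingEnd ℂ) h
  simpa [cone] using this

/-- A map over the base that acts on the parameters of the conics as a quaternion does is the
rotation by this quaternion. -/
theorem same_rotRep {F : DomRep} (hF : F.OverBase) {h : Quat} (hh : h ≠ 0)
    (hlin : ∀ v ∈ cone, ∀ t, v 3 = t * v 0 → v 0 ≠ 0 → 1 - t ^ 2 ≠ 0 →
      v 1 - Complex.I * v 2 ≠ 0 → ev F.forms v 0 ≠ 0 →
      ev F.forms v 0 * linV h t v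
        = (ev F.forms v 1 - Complex.I * ev F.forms v 2) * linU h t v) :
    DomRep.Same F (rotRep h hh) := by
  refine same_of_ne (mul_not_vanish (mul_not_vanish X_zero_ne norm_form_not_vanish)
    F.zero_not_vanish) fun v hv h0 => ?_
  rw [map_mul] at h0
  obtain ⟨h0, hf⟩ := mul_ne_zero_iff.1 h0
  obtain ⟨t, ht, hw, hd, -, hV⟩ := exists_slope_of_norm_ne_zero hv h0
  have hq := cone_mul_eq ht hv
  have l := hlin v hv t ht hw hd hV hf
  have z0 := act_zero_param h hq
  have z1 := act_sub_param h hq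
  have z2 := act_add_param h hq
  have hf' : ev F.forms v 0 ≠ 0 := hf
  have f3 : ev F.forms v 3 = t * ev F.forms v 0 := by
    have := hF v hv
    rw [ht] at this
    exact mul_left_cancel₀ hw (by linear_combination this)
  have fq := cone_mul_eq f3 (F.mapsTo v hv)
  rw [ev_rotRep hh ht]
  set V := v 1 - Complex.I * v 2
  set f := ev F.forms v
  set m := f 1 - Complex.I * f 2 with hm
  set U' := linU h t v
  set V' := linV h t v
  have hm0 : m ≠ 0 := by
    intro h1
    rw [h1, mul_zero] at fq
    exact mul_ne_zero hd (pow_ne_zero 2 hf') fq.symm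
  have hmV : m * V ≠ 0 := mul_ne_zero hm0 hV
  have c0 : act h t v 0 * (m * V) = V' ^ 2 * f 0 := by
    linear_combination m * z0 - V' * l
  have c1 : (act h t v 1 - Complex.I * act h t v 2) * (m * V) = V' ^ 2 * m := by
    linear_combination m * z1
  have c2 : (act h t v 1 + Complex.I * act h t v 2) * (m * V)
      = V' ^ 2 * (f 1 + Complex.I * f 2) := by
    refine mul_left_cancel₀ hm0 ?_
    linear_combination m ^ 2 * z2 - V' ^ 2 * fq - (1 - t ^ 2) * (f 0 * V' + m * U') * l
  have hI := Complex.I_sq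
  have prop : ∀ i, act h t v i * (m * V) = V' ^ 2 * f i := by
    intro i
    fin_cases i
    · exact c0
    · change act h t v 1 * (m * V) = V' ^ 2 * f 1
      linear_combination (c1 + c2) / 2 + V' ^ 2 / 2 * hm
    · change act h t v 2 * (m * V) = V' ^ 2 * f 2
      linear_combination (-Complex.I / 2) * (c2 - c1) + Complex.I / 2 * V' ^ 2 * hm
        + (act h t v 2 * (m * V) - V' ^ 2 * f 2) * hI
    · change act h t v 3 * (m * V) = V' ^ 2 * f 3
      rw [act_three, f3]
      linear_combination t * c0
  intro i j
  simp only [Pi.smul_apply, smul_eq_mul]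
  refine mul_right_cancel₀ hmV ?_
  linear_combination v 0 ^ (rotDeg h + 1) * (f i * prop j - f j * prop i)

/-- Every birational map over the base is a rotation: it acts on the parameters of the complex
conics by a homography, and invariance under complex conjugation makes the homography
proportional to one that comes from a quaternion. -/
theorem exists_rotBir (A : BirOverBase) : ∃ (h : Quat) (hh : h ≠ 0), A = rotBir h hh := by
  obtain ⟨F, hFA, hF⟩ := A.2
  obtain ⟨G, hG⟩ := Quotient.exists_rep (A.1⁻¹ : BirSphere).val
  have hGF : DomRep.Same (DomRep.comp G F) DomRep.one := by
    have h : (A.1⁻¹ : BirSphere).val * A.1.val = 1 := A.1.inv_mul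
    unfold Represents at hFA
    rw [← hFA, ← hG] at h
    exact Quotient.exact h
  obtain ⟨α, β, γ, κ, hne, hm⟩ := exists_homography hF hGF
  obtain ⟨α₁, α₂, hα⟩ := exists_real_imag α
  obtain ⟨β₁, β₂, hβ⟩ := exists_real_imag β
  obtain ⟨γ₁, γ₂, hγ⟩ := exists_real_imag γ
  obtain ⟨κ₁, κ₂, hκ⟩ := exists_real_imag κ
  have lin : ∀ v ∈ cone, ∀ t, v 3 = t * v 0 → v 1 - Complex.I * v 2 ≠ 0 →
      ev F.forms v 0 * ((aeval t γ₁ + Complex.I * aeval t γ₂) * v 0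
          + (aeval t κ₁ + Complex.I * aeval t κ₂) * (v 1 - Complex.I * v 2))
        = ((aeval t α₁ + Complex.I * aeval t α₂) * v 0
          + (aeval t β₁ + Complex.I * aeval t β₂) * (v 1 - Complex.I * v 2))
        * (ev F.forms v 1 - Complex.I * ev F.forms v 2) := by
    intro v hv t ht hV
    set V := v 1 - Complex.I * v 2 with hVdef
    have e := congrArg (evalEval t (v 0 / V)) hm
    simp only [evalEval_mul, evalEval_add, evalEval_C, evalEval_X, genSub, evalEval_sub,
      evalEval_aeval_genPt, eval_C, hα, hβ, hγ, hκ] at e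
    have hs := eq_smul_numPt ht hv hV
    rw [← hVdef] at hs
    have hFv : ∀ i, ev F.forms v i
        = V ^ F.deg * MvPolynomial.aeval (numPt t (v 0 / V)) (F.forms i) := by
      intro i
      conv_lhs => rw [hs, ev_smul F.homog]
      rfl
    rw [hFv, hFv, hFv]
    have hw : v 0 = V * (v 0 / V) := by field_simp
    generalize v 0 / V = s at *
    rw [hw]
    linear_combination V ^ F.deg * V * e
  have linc : ∀ v ∈ cone, ∀ t, v 3 = t * v 0 → v 1 + Complex.I * v 2 ≠ 0 →
      ev F.forms v 0 * ((aeval t γ₁ - Complex.I * aeval t γ₂) * v 0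
          + (aeval t κ₁ - Complex.I * aeval t κ₂) * (v 1 + Complex.I * v 2))
        = ((aeval t α₁ - Complex.I * aeval t α₂) * v 0
          + (aeval t β₁ - Complex.I * aeval t β₂) * (v 1 + Complex.I * v 2))
        * (ev F.forms v 1 + Complex.I * ev F.forms v 2) := by
    intro v hv t ht hV
    have e := lin _ (conj_mem_cone hv) (starRingEnd ℂ t) (by rw [ht, map_mul])
      (by
        intro h0
        apply hV
        have := congrArg (starRingEnd ℂ) h0
        simpa using this)
    rw [ev_conj, ev_conj, ev_conj] at e
    simp only [aeval_conj] at e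
    have := congrArg (starRingEnd ℂ) e
    simpa [sub_eq_add_neg] using this
  -- The conjugate homography, read in the coordinates `u = w`, `v = x - i y`.
  have linc' : ∀ v ∈ cone, ∀ t, v 3 = t * v 0 → v 0 ≠ 0 → 1 - t ^ 2 ≠ 0 →
      v 1 - Complex.I * v 2 ≠ 0 → ev F.forms v 0 ≠ 0 →
      (ev F.forms v 1 - Complex.I * ev F.forms v 2)
          * ((aeval t γ₁ - Complex.I * aeval t γ₂) * (v 1 - Complex.I * v 2)
            + (aeval t κ₁ - Complex.I * aeval t κ₂) * ((1 - t ^ 2) * v 0))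
        = (1 - t ^ 2) * ev F.forms v 0
          * ((aeval t α₁ - Complex.I * aeval t α₂) * (v 1 - Complex.I * v 2)
          + (aeval t β₁ - Complex.I * aeval t β₂) * ((1 - t ^ 2) * v 0)) := by
    intro v hv t ht hw hd hV hf
    have hq := cone_mul_eq ht hv
    have hP : v 1 + Complex.I * v 2 ≠ 0 := by
      intro h0
      rw [h0, zero_mul] at hq
      exact mul_ne_zero hd (pow_ne_zero 2 hw) hq.symm
    have e := linc v hv t ht hP
    have f3 : ev F.forms v 3 = t * ev F.forms v 0 := by
      have := hF v hv
      rw [ht] at this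
      exact mul_left_cancel₀ hw (by linear_combination this)
    have fq := cone_mul_eq f3 (F.mapsTo v hv)
    set V := v 1 - Complex.I * v 2
    set P := v 1 + Complex.I * v 2
    set m := ev F.forms v 1 - Complex.I * ev F.forms v 2
    set p := ev F.forms v 1 + Complex.I * ev F.forms v 2
    refine mul_left_cancel₀ (mul_ne_zero hf hw) ?_
    linear_combination m * V * e
      - ev F.forms v 0 * m * (aeval t κ₁ - Complex.I * aeval t κ₂) * hq
      + p * m * (aeval t β₁ - Complex.I * aeval t β₂) * hq
      + ((aeval t α₁ - Complex.I * aeval t α₂) * V * v 0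
        + (aeval t β₁ - Complex.I * aeval t β₂) * ((1 - t ^ 2) * v 0 ^ 2)) * fq
  -- The sum of a homography and its conjugate, and `i` times their difference, are quaternions.
  set h₁ : Quat := ⟨(1 - X ^ 2) * (α₁ + κ₁), (1 - X ^ 2) * (α₂ - κ₂),
    (1 - X ^ 2) * β₁ + γ₁, (1 - X ^ 2) * β₂ - γ₂⟩ with hh₁
  set h₂ : Quat := ⟨-((1 - X ^ 2) * (α₂ + κ₂)), (1 - X ^ 2) * (α₁ - κ₁),
    -((1 - X ^ 2) * β₂ + γ₂), (1 - X ^ 2) * β₁ - γ₁⟩ with hh₂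
  have hI := Complex.I_sq
  by_cases h10 : h₁ = 0
  · have h20 : h₂ ≠ 0 := by
      intro h20
      have a1 := congrArg QuaternionAlgebra.re h10
      have a2 := congrArg QuaternionAlgebra.imI h10
      have a3 := congrArg QuaternionAlgebra.imJ h10
      have a4 := congrArg QuaternionAlgebra.imK h10
      have b1 := congrArg QuaternionAlgebra.re h20
      have b2 := congrArg QuaternionAlgebra.imI h20
      have b3 := congrArg QuaternionAlgebra.imJ h20
      have b4 := congrArg QuaternionAlgebra.imK h20
      simp only [hh₁, hh₂, QuaternionAlgebra.re_zero, QuaternionAlgebra.imI_zero,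
        QuaternionAlgebra.imJ_zero, QuaternionAlgebra.imK_zero] at a1 a2 a3 a4 b1 b2 b3 b4
      have hd := one_sub_sq_ne_zero
      have two : ∀ p : ℝ[X], 2 * p = 0 → p = 0 := fun p hp =>
        (mul_eq_zero.1 hp).resolve_left two_ne_zero
      have g1 : γ₁ = 0 := two _ (by linear_combination a3 - b4)
      have g2 : γ₂ = 0 := two _ (by linear_combination -a4 - b3)
      have k1 : κ₁ = 0 := by
        refine two _ ((mul_eq_zero.1 (?_ : (1 - X ^ 2) * (2 * κ₁) = 0)).resolve_left hd)
        linear_combination a1 - b2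
      have k2 : κ₂ = 0 := by
        refine two _ ((mul_eq_zero.1 (?_ : (1 - X ^ 2) * (2 * κ₂) = 0)).resolve_left hd)
        linear_combination -a2 - b1
      rcases hne with h0 | h0
      · exact h0 (Polynomial.funext fun t => by rw [hγ, g1, g2]; simp)
      · exact h0 (Polynomial.funext fun t => by rw [hκ, k1, k2]; simp)
    refine ⟨h₂, h20, eq_of_represents hFA (represents_rotBir h20) (same_rotRep hF h20 ?_)⟩
    intro v hv t ht hw hd hV hf
    have e1 := lin v hv t ht hV
    have e2 := linc' v hv t ht hw hd hV hf
    simp only [linU, linV, hh₂, map_neg, map_sub, map_mul, map_add, map_pow, map_one, aeval_X]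
    linear_combination Complex.I * ((1 - t ^ 2) * e1 + e2)
      - (ev F.forms v 0 * ((1 - t ^ 2) * ((1 - t ^ 2) * aeval t β₂ + aeval t γ₂) * v 0
          + (1 - t ^ 2) * (aeval t α₂ + aeval t κ₂) * (v 1 - Complex.I * v 2))
        - (ev F.forms v 1 - Complex.I * ev F.forms v 2)
          * ((1 - t ^ 2) * (aeval t α₂ + aeval t κ₂) * v 0
            + ((1 - t ^ 2) * aeval t β₂ + aeval t γ₂) * (v 1 - Complex.I * v 2))) * hI
  · refine ⟨h₁, h10, eq_of_represents hFA (represents_rotBir h10) (same_rotRep hF h10 ?_)⟩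
    intro v hv t ht hw hd hV hf
    have e1 := lin v hv t ht hV
    have e2 := linc' v hv t ht hw hd hV hf
    simp only [linU, linV, hh₁, map_sub, map_mul, map_add, map_pow, map_one, aeval_X]
    linear_combination (1 - t ^ 2) * e1 - e2

/-! ### Involutions and their axes -/

/-- The square of a pure quaternion `v`, as a polynomial. The imaginary parts of `v` alone enter. -/
noncomputable def qdisc (v : Quat) : ℝ[X] :=
  (1 - X ^ 2) * (v.imJ ^ 2 + v.imK ^ 2) - v.imI ^ 2

theorem qnorm_of_pure {v : Quat} (hv : v.re = 0) : qnorm v = -qdisc v := by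
  rw [qnorm, qdisc, hv]; ring

theorem qdisc_ne_zero {v : Quat} (hv : v.re = 0) (h0 : v ≠ 0) : qdisc v ≠ 0 := fun h =>
  qnorm_ne_zero h0 (by rw [qnorm_of_pure hv, h, neg_zero])

/-- An element of order two is the rotation by a pure quaternion: `h²` is a scalar, and so `h` is a
scalar unless its real part is zero. -/
theorem exists_pure_of_orderOf {A : BirOverBase} (hA : orderOf A = 2) :
    ∃ (v : Quat) (h0 : v ≠ 0), v.re = 0 ∧ A = rotBir v h0 := by
  obtain ⟨h, hh, rfl⟩ := exists_rotBir A
  refine ⟨h, hh, ?_, rfl⟩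
  have h2 : rotBir h hh * rotBir h hh = 1 := by
    rw [← pow_two, ← hA]; exact pow_orderOf_eq_one _
  rw [rotBir_mul] at h2
  obtain ⟨e1, e2, e3⟩ := im_eq_zero_of_rotBir_eq_one _ h2
  by_contra hre
  have two : ∀ p : ℝ[X], 2 * h.re * p = 0 → p = 0 := fun p hp =>
    (mul_eq_zero.1 hp).resolve_left (mul_ne_zero two_ne_zero hre)
  have hc : h = ((h.re : ℝ[X]) : Quat) := by
    ext1
    · rfl
    · refine two _ ?_
      rw [QuaternionAlgebra.imI_mul] at e1
      linear_combination e1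
    · refine two _ ?_
      rw [QuaternionAlgebra.imJ_mul] at e2
      linear_combination e2
    · refine two _ ?_
      rw [QuaternionAlgebra.imK_mul] at e3
      linear_combination e3
  have h1 : rotBir h hh = 1 := by
    rw [rotBir_congr hh (hc ▸ hh) hc, rotBir_coe]
  rw [h1, orderOf_one] at hA
  omega

/-- The linear form that cuts out of the plane `z = t w` the fixed points of the rotation by a pure
quaternion. -/
noncomputable def axisForm (v : Quat) (t : ℂ) (p : Fin 4 → ℂ) : ℂ :=
  aeval t v.imI * p 0 + aeval t v.imK * p 1 - aeval t v.imJ * p 2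

/-- The axis of the half-turn by a pure quaternion. -/
noncomputable def axisVec (v : Quat) (t : ℂ) : Fin 4 → ℂ :=
  ![aeval t v.imI, -((1 - t ^ 2) * aeval t v.imK), (1 - t ^ 2) * aeval t v.imJ,
    t * aeval t v.imI]

theorem axisForm_smul (v : Quat) (t c : ℂ) (p : Fin 4 → ℂ) :
    axisForm v t (c • p) = c * axisForm v t p := by
  simp only [axisForm, Pi.smul_apply, smul_eq_mul]; ring

theorem aeval_qdisc (v : Quat) (t : ℂ) : aeval t (qdisc v)
    = (1 - t ^ 2) * (aeval t v.imJ ^ 2 + aeval t v.imK ^ 2) - aeval t v.imI ^ 2 := by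
  simp [qdisc]

/-- The rotation by a pure quaternion is, up to a scalar, the half-turn about its axis: it fixes the
axis and the points of its polar. -/
theorem act_pure {v : Quat} (hv : v.re = 0) {t : ℂ} {p : Fin 4 → ℂ} (hp : p 3 = t * p 0) :
    act v t p = aeval t (qdisc v) • p + (2 * axisForm v t p) • axisVec v t := by
  have e0 : act v t p 0 = aeval t (qdisc v) * p 0 + 2 * axisForm v t p * aeval t v.imI := by
    rw [act_zero_eq, aeval_qdisc, axisForm, hv, map_zero]; ring
  ext i
  fin_cases i
  · exact e0
  · change act v t p 1 = aeval t (qdisc v) * p 1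
      + 2 * axisForm v t p * -((1 - t ^ 2) * aeval t v.imK)
    rw [act_one_eq, aeval_qdisc, axisForm, hv, map_zero]; ring
  · change act v t p 2 = aeval t (qdisc v) * p 2
      + 2 * axisForm v t p * ((1 - t ^ 2) * aeval t v.imJ)
    rw [act_two_eq, aeval_qdisc, axisForm, hv, map_zero]; ring
  · change act v t p 3 = aeval t (qdisc v) * p 3
      + 2 * axisForm v t p * (t * aeval t v.imI)
    rw [act_three, e0, hp]; ring

/-- The fixed points of a half-turn on the conic lie on the polar of its axis: the axis itself is
not on the conic. -/
theorem axisForm_eq_zero {v : Quat} (hv : v.re = 0) {t : ℂ} {p : Fin 4 → ℂ}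
    (hp : p 3 = t * p 0) (hc : p ∈ cone) (h0 : p ≠ 0) (hd : 1 - t ^ 2 ≠ 0)
    (hN : aeval t (qdisc v) ≠ 0)
    (h : ∀ i j, act v t p i * p j = act v t p j * p i) : axisForm v t p = 0 := by
  by_contra hl
  obtain ⟨c, hc'⟩ := DomRep.exists_smul h0 (b := axisVec v t) fun i j => by
    have := h i j
    rw [act_pure hv hp] at this
    simp only [Pi.add_apply, Pi.smul_apply, smul_eq_mul] at this
    refine mul_left_cancel₀ (mul_ne_zero two_ne_zero hl) ?_
    linear_combination -this
  have e0 : aeval t v.imI = c * p 0 := congrFun hc' 0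
  have e1 : -((1 - t ^ 2) * aeval t v.imK) = c * p 1 := congrFun hc' 1
  have e2 : (1 - t ^ 2) * aeval t v.imJ = c * p 2 := congrFun hc' 2
  rw [mem_cone_iff hp] at hc
  refine mul_ne_zero hd hN ?_
  rw [aeval_qdisc]
  linear_combination c ^ 2 * hc
    + ((1 - t ^ 2) * aeval t v.imJ + c * p 2) * e2
    + (-((1 - t ^ 2) * aeval t v.imK) + c * p 1) * e1
    - (1 - t ^ 2) * (aeval t v.imI + c * p 0) * e0

/-! ### The curve cut out by the polar plane of the axis -/

/-- The curve of the points of the conics `Γ_t` on the polar of the axis of a half-turn. -/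
def polarCurve (v : Quat) : Set Pt :=
  {P | P.1 ∈ fibre P.2 ∧ axisForm v P.2 P.1.rep = 0}

theorem exists_rep_smul {w : Fin 4 → ℂ} (hw : w ≠ 0) :
    ∃ c : ℂ, c ≠ 0 ∧ (Projectivization.mk ℂ w hw).rep = c • w := by
  obtain ⟨a, ha⟩ := Projectivization.exists_smul_eq_mk_rep ℂ w hw
  exact ⟨a, a.ne_zero, ha.symm⟩

theorem smul_mem_cone {c : ℂ} (hc : c ≠ 0) {w : Fin 4 → ℂ} : c • w ∈ cone ↔ w ∈ cone := by
  simp only [cone, Set.mem_ofPred_eq, Pi.smul_apply, smul_eq_mul]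
  constructor
  · intro h
    exact mul_left_cancel₀ (pow_ne_zero 2 hc) (by linear_combination h)
  · intro h
    linear_combination c ^ 2 * h

theorem mk_mem_fibre {w : Fin 4 → ℂ} (hw : w ≠ 0) {t : ℂ} :
    Projectivization.mk ℂ w hw ∈ fibre t ↔ w ∈ cone ∧ w 3 = t * w 0 := by
  obtain ⟨c, hc, e⟩ := exists_rep_smul hw
  simp only [fibre, Set.mem_ofPred_eq, e, smul_mem_cone hc, Pi.smul_apply, smul_eq_mul]
  refine and_congr_right fun _ => ⟨fun h => mul_left_cancel₀ hc (by linear_combination h),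
    fun h => by linear_combination c * h⟩

theorem mk_mem_polarCurve {v : Quat} {w : Fin 4 → ℂ} (hw : w ≠ 0) {t : ℂ} :
    ((Projectivization.mk ℂ w hw, t) : Pt) ∈ polarCurve v
      ↔ w ∈ cone ∧ w 3 = t * w 0 ∧ axisForm v t w = 0 := by
  obtain ⟨c, hc, e⟩ := exists_rep_smul hw
  simp only [polarCurve, Set.mem_ofPred_eq, mk_mem_fibre hw, e, axisForm_smul, mul_eq_zero, hc,
    false_or, and_assoc]

/-- The map of coefficients of polynomials over the base at a value of `t`. -/
noncomputable abbrev evBase (k : Type) [CommRing k] [Algebra k ℂ] (t : ℂ) : k[X] →+* ℂ :=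
  Polynomial.eval₂RingHom (algebraMap k ℂ) t

theorem evBase_apply {k : Type} [CommRing k] [Algebra k ℂ] (t : ℂ) (p : k[X]) :
    evBase k t p = aeval t p := rfl

theorem value_mk {k : Type} [CommRing k] [Algebra k ℂ] {f : MvPolynomial (Fin 4) k[X]} {d : ℕ}
    (hf : f.IsHomogeneous d) {w : Fin 4 → ℂ} (hw : w ≠ 0) (t : ℂ) :
    value f (Projectivization.mk ℂ w hw, t) = 0 ↔ f.eval₂ (evBase k t) w = 0 := by
  obtain ⟨c, hc, e⟩ := exists_rep_smul hw
  simp only [value, e]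
  rw [eval₂_smul_of_isHomogeneous _ hf, mul_eq_zero]
  simp [hc]

theorem zariskiClosure_subset {T Z : Set Pt} (hZ : IsZariskiClosed Z) (h : T ⊆ Z) :
    zariskiClosure T ⊆ Z := Set.sInter_subset_of_mem ⟨hZ, h⟩

theorem isZariskiClosed_zeroLocus {f : MvPolynomial (Fin 4) ℂ[X]} {d : ℕ}
    (hf : f.IsHomogeneous d) : IsZariskiClosed {P | value f P = 0} :=
  ⟨{f}, by rintro _ rfl; exact ⟨d, hf⟩, by simp⟩

/-- A form that vanishes on a set vanishes on its closure. -/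
theorem value_eq_zero_of_mem_closure {k : Type} [CommRing k] [Algebra k ℂ]
    {f : MvPolynomial (Fin 4) k[X]} {d : ℕ} (hf : f.IsHomogeneous d) {T : Set Pt}
    (h : ∀ P ∈ T, value f P = 0) {P : Pt} (hP : P ∈ zariskiClosure T) : value f P = 0 := by
  have e : ∀ Q : Pt, value (MvPolynomial.map (Polynomial.mapRingHom (algebraMap k ℂ)) f) Q
      = value f Q := by
    intro Q
    simp only [value, MvPolynomial.eval₂_map]
    congr 1
    ext x
    · simp
    · simp
  have := zariskiClosure_subset (isZariskiClosed_zeroLocus (hf.map _))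
    (fun Q hQ => by
      change value _ Q = 0
      rw [e]; exact h Q hQ) hP
  rwa [← e]

theorem isZariskiClosed_polarCurve (v : Quat) : IsZariskiClosed (polarCurve v) := by
  let f₁ : MvPolynomial (Fin 4) ℂ[X] := MvPolynomial.X 0 ^ 2 - MvPolynomial.X 1 ^ 2
    - MvPolynomial.X 2 ^ 2 - MvPolynomial.X 3 ^ 2
  let f₂ : MvPolynomial (Fin 4) ℂ[X] := MvPolynomial.X 3 - MvPolynomial.C X * MvPolynomial.X 0
  let f₃ : MvPolynomial (Fin 4) ℂ[X] :=
    MvPolynomial.C (v.imI.map (algebraMap ℝ ℂ)) * MvPolynomial.X 0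
    + MvPolynomial.C (v.imK.map (algebraMap ℝ ℂ)) * MvPolynomial.X 1
    - MvPolynomial.C (v.imJ.map (algebraMap ℝ ℂ)) * MvPolynomial.X 2
  have hX : ∀ i, (MvPolynomial.X i : MvPolynomial (Fin 4) ℂ[X]).IsHomogeneous 1 := fun i =>
    MvPolynomial.isHomogeneous_X _ i
  have hX2 : ∀ i, (MvPolynomial.X i ^ 2 : MvPolynomial (Fin 4) ℂ[X]).IsHomogeneous 2 := fun i =>
    MvPolynomial.isHomogeneous_X_pow i 2
  refine ⟨{f₁, f₂, f₃}, ?_, ?_⟩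
  · rintro f (rfl | rfl | rfl)
    · exact ⟨2, (((hX2 0).sub (hX2 1)).sub (hX2 2)).sub (hX2 3)⟩
    · exact ⟨1, (hX 3).sub ((hX 0).C_mul _)⟩
    · exact ⟨1, (((hX 0).C_mul _).add ((hX 1).C_mul _)).sub ((hX 2).C_mul _)⟩
  · ext P
    have e1 : value f₁ P = P.1.rep 0 ^ 2 - P.1.rep 1 ^ 2 - P.1.rep 2 ^ 2 - P.1.rep 3 ^ 2 := by
      simp [f₁, value]
    have e2 : value f₂ P = P.1.rep 3 - P.2 * P.1.rep 0 := by
      simp [f₂, value]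
    have e3 : value f₃ P = axisForm v P.2 P.1.rep := by
      simp [f₃, value, axisForm, Polynomial.eval_map, Polynomial.aeval_def]
    simp only [polarCurve, fibre, cone, Set.mem_ofPred_eq, Set.mem_insert_iff,
      Set.mem_singleton_iff, forall_eq_or_imp, forall_eq, e1, e2, e3]
    constructor
    · rintro ⟨⟨h1, h2⟩, h3⟩
      exact ⟨by linear_combination h1, by linear_combination h2, h3⟩
    · rintro ⟨h1, h2, h3⟩
      exact ⟨⟨by linear_combination h1, by linear_combination h2⟩, h3⟩

/-! ### Parametrization of the polar curve by a double cover of the base -/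

/-- A polynomial parametrization `r E + G`, with `r²` the square of the pure quaternion `v`, of the
polar curve of `v`, in the coordinates `w, x, y`. The vectors `E` and `G` span the polar of the
axis, and are orthogonal for the quadratic form `x² + y² - (1 - t²) w²` of the conic, where they
have the values `n` and `-n v²`. The linear forms `α` and `γ` give the coefficients of `E` and `G`,
up to the factor `m`: by `decomp`, the endomorphism `m - α E - γ G` is a multiple, by the vector
`W`, of the linear form that cuts out the polar. -/
structure Frame (v : Quat) where
  E : Fin 3 → ℝ[X]
  G : Fin 3 → ℝ[X]
  α : Fin 3 → ℝ[X]
  γ : Fin 3 → ℝ[X]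
  W : Fin 3 → ℝ[X]
  m : ℝ[X]
  n : ℝ[X]
  m_ne : m ≠ 0
  n_ne : n ≠ 0
  axis_E : v.imI * E 0 + v.imK * E 1 - v.imJ * E 2 = 0
  axis_G : v.imI * G 0 + v.imK * G 1 - v.imJ * G 2 = 0
  norm_E : E 1 ^ 2 + E 2 ^ 2 - (1 - X ^ 2) * E 0 ^ 2 = n
  norm_G : G 1 ^ 2 + G 2 ^ 2 - (1 - X ^ 2) * G 0 ^ 2 = -(n * qdisc v)
  orth : E 1 * G 1 + E 2 * G 2 - (1 - X ^ 2) * (E 0 * G 0) = 0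
  γ_E : γ 0 * E 0 + γ 1 * E 1 + γ 2 * E 2 = 0
  γ_G : γ 0 * G 0 + γ 1 * G 1 + γ 2 * G 2 = m
  decomp : ∀ i j, (if i = j then m else 0) - α j * E i - γ j * G i
    = ![v.imI, v.imK, -v.imJ] j * W i

theorem exists_frame {v : Quat} (hv : v.re = 0) (h0 : v ≠ 0) : Nonempty (Frame v) := by
  by_cases hb : v.imJ ^ 2 + v.imK ^ 2 = 0
  · -- The axis is the point `x = y = 0`, whose polar is the line `w = 0`.
    have key : ∀ t : ℝ, v.imJ.eval t = 0 ∧ v.imK.eval t = 0 := by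
      intro t
      have h1 := congrArg (eval t) hb
      simp only [eval_add, eval_pow, eval_zero] at h1
      have p1 := sq_nonneg (v.imJ.eval t)
      have p2 := sq_nonneg (v.imK.eval t)
      exact ⟨pow_eq_zero_iff two_ne_zero |>.1 (by linarith),
        pow_eq_zero_iff two_ne_zero |>.1 (by linarith)⟩
    have hJ : v.imJ = 0 := Polynomial.funext fun t => by rw [(key t).1, eval_zero]
    have hK : v.imK = 0 := Polynomial.funext fun t => by rw [(key t).2, eval_zero]
    have hI : v.imI ≠ 0 := fun hI => h0 (by ext1 <;> assumption)
    exact ⟨{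
      E := ![0, 1, 0]
      G := ![0, 0, v.imI]
      α := ![0, v.imI, 0]
      γ := ![0, 0, 1]
      W := ![1, 0, 0]
      m := v.imI
      n := 1
      m_ne := hI
      n_ne := one_ne_zero
      axis_E := by simp [hJ, hK]
      axis_G := by simp [hJ, hK]
      norm_E := by simp
      norm_G := by simp [qdisc, hJ, hK]
      orth := by simp
      γ_E := by simp
      γ_G := by simp
      decomp := by
        intro i j
        fin_cases i <;> fin_cases j <;> simp [hJ, hK] }⟩
  · exact ⟨{
      E := ![0, v.imJ, v.imK]
      G := ![v.imJ ^ 2 + v.imK ^ 2, -(v.imI * v.imK), v.imI * v.imJ]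
      α := ![0, v.imJ, v.imK]
      γ := ![1, 0, 0]
      W := ![0, v.imK, -v.imJ]
      m := v.imJ ^ 2 + v.imK ^ 2
      n := v.imJ ^ 2 + v.imK ^ 2
      m_ne := hb
      n_ne := hb
      axis_E := by simp; ring
      axis_G := by simp; ring
      norm_E := by simp
      norm_G := by simp [qdisc]; ring
      orth := by simp; ring
      γ_E := by simp
      γ_G := by simp
      decomp := by
        intro i j
        fin_cases i <;> fin_cases j <;> simp <;> ring }⟩

namespace Frame

variable {v : Quat} (Φ : Frame v)

/-- The constant part of the parametrization, in the coordinates `w, x, y, z`. -/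
noncomputable def base : Fin 4 → ℝ[X] := ![Φ.G 0, Φ.G 1, Φ.G 2, X * Φ.G 0]

/-- The coefficient of `r` in the parametrization, in the coordinates `w, x, y, z`. -/
noncomputable def dir : Fin 4 → ℝ[X] := ![Φ.E 0, Φ.E 1, Φ.E 2, X * Φ.E 0]

/-- The point of the polar curve with parameters `t` and `r`. -/
noncomputable def pt (t r : ℂ) : Fin 4 → ℂ := fun i => aeval t (Φ.base i) + r * aeval t (Φ.dir i)

/-- The form `α` at a point. -/
noncomputable def formα (t : ℂ) (p : Fin 4 → ℂ) : ℂ :=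
  aeval t (Φ.α 0) * p 0 + aeval t (Φ.α 1) * p 1 + aeval t (Φ.α 2) * p 2

/-- The form `γ` at a point. -/
noncomputable def formγ (t : ℂ) (p : Fin 4 → ℂ) : ℂ :=
  aeval t (Φ.γ 0) * p 0 + aeval t (Φ.γ 1) * p 1 + aeval t (Φ.γ 2) * p 2

theorem pt_zero (t r : ℂ) : Φ.pt t r 0 = aeval t (Φ.G 0) + r * aeval t (Φ.E 0) := rfl
theorem pt_one (t r : ℂ) : Φ.pt t r 1 = aeval t (Φ.G 1) + r * aeval t (Φ.E 1) := rfl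
theorem pt_two (t r : ℂ) : Φ.pt t r 2 = aeval t (Φ.G 2) + r * aeval t (Φ.E 2) := rfl

theorem pt_three (t r : ℂ) : Φ.pt t r 3 = t * Φ.pt t r 0 := by
  have : Φ.pt t r 3 = aeval t (X * Φ.G 0) + r * aeval t (X * Φ.E 0) := rfl
  rw [this, pt_zero, map_mul, map_mul, aeval_X]; ring

theorem formγ_pt (t r : ℂ) : Φ.formγ t (Φ.pt t r) = aeval t Φ.m := by
  have h1 := congrArg (aeval t) Φ.γ_E
  have h2 := congrArg (aeval t) Φ.γ_G
  simp only [map_add, map_mul, map_zero] at h1 h2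
  rw [formγ, pt_zero, pt_one, pt_two]
  linear_combination r * h1 + h2

theorem pt_ne_zero {t : ℂ} (hm : aeval t Φ.m ≠ 0) (r : ℂ) : Φ.pt t r ≠ 0 := by
  intro h
  have := Φ.formγ_pt t r
  rw [h] at this
  simp [formγ] at this
  exact hm this.symm

theorem pt_mem_cone {t r : ℂ} (hr : r ^ 2 = aeval t (qdisc v)) : Φ.pt t r ∈ cone := by
  have h1 := congrArg (aeval t) Φ.norm_E
  have h2 := congrArg (aeval t) Φ.norm_G
  have h3 := congrArg (aeval t) Φ.orth
  simp only [map_add, map_sub, map_mul, map_pow, map_neg, map_zero, map_one, aeval_X] at h1 h2 h3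
  rw [mem_cone_iff (Φ.pt_three t r), pt_zero, pt_one, pt_two]
  linear_combination r ^ 2 * h1 + h2 + 2 * r * h3 + aeval t Φ.n * hr

theorem axisForm_pt (t r : ℂ) : axisForm v t (Φ.pt t r) = 0 := by
  have h1 := congrArg (aeval t) Φ.axis_E
  have h2 := congrArg (aeval t) Φ.axis_G
  simp only [map_add, map_sub, map_mul, map_zero] at h1 h2
  rw [axisForm, pt_zero, pt_one, pt_two]
  linear_combination r * h1 + h2

theorem m_mul {t : ℂ} {p : Fin 4 → ℂ} (hl : axisForm v t p = 0) (i : Fin 3) :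
    aeval t Φ.m * p i.castSucc
      = Φ.formα t p * aeval t (Φ.E i) + Φ.formγ t p * aeval t (Φ.G i) := by
  have h0 := congrArg (aeval t) (Φ.decomp i 0)
  have h1 := congrArg (aeval t) (Φ.decomp i 1)
  have h2 := congrArg (aeval t) (Φ.decomp i 2)
  simp only [map_sub, map_mul, Matrix.cons_val_zero, Matrix.cons_val_one, Matrix.cons_val,
    map_neg] at h0 h1 h2
  rw [axisForm] at hl
  rw [formα, formγ]
  fin_cases i
  · simp at h0 h1 h2 ⊢
    linear_combination p 0 * h0 + p 1 * h1 + p 2 * h2 + aeval t (Φ.W 0) * hl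
  · simp at h0 h1 h2 ⊢
    linear_combination p 0 * h0 + p 1 * h1 + p 2 * h2 + aeval t (Φ.W 1) * hl
  · simp at h0 h1 h2 ⊢
    linear_combination p 0 * h0 + p 1 * h1 + p 2 * h2 + aeval t (Φ.W 2) * hl

/-- On the polar curve the ratio of the forms `α` and `γ` is a square root of `v²`. -/
theorem formα_sq {t : ℂ} {p : Fin 4 → ℂ} (hn : aeval t Φ.n ≠ 0)
    (hp : p 3 = t * p 0) (hc : p ∈ cone) (hl : axisForm v t p = 0) :
    Φ.formα t p ^ 2 = aeval t (qdisc v) * Φ.formγ t p ^ 2 := by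
  have e0 := Φ.m_mul hl 0
  have e1 := Φ.m_mul hl 1
  have e2 := Φ.m_mul hl 2
  simp only [Fin.castSucc_zero, Fin.castSucc_one, show Fin.castSucc (2 : Fin 3) = 2 from rfl]
    at e0 e1 e2
  have h1 := congrArg (aeval t) Φ.norm_E
  have h2 := congrArg (aeval t) Φ.norm_G
  have h3 := congrArg (aeval t) Φ.orth
  simp only [map_add, map_sub, map_mul, map_pow, map_neg, map_zero, map_one, aeval_X] at h1 h2 h3
  rw [mem_cone_iff hp] at hc
  have hq : (aeval t Φ.m * p 1) ^ 2 + (aeval t Φ.m * p 2) ^ 2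
      = (1 - t ^ 2) * (aeval t Φ.m * p 0) ^ 2 := by
    linear_combination aeval t Φ.m ^ 2 * hc
  rw [e0, e1, e2] at hq
  refine mul_left_cancel₀ hn ?_
  linear_combination hq - Φ.formα t p ^ 2 * h1 - Φ.formγ t p ^ 2 * h2
    - 2 * Φ.formα t p * Φ.formγ t p * h3

theorem formγ_ne_zero {t : ℂ} {p : Fin 4 → ℂ} (hm : aeval t Φ.m ≠ 0) (hn : aeval t Φ.n ≠ 0)
    (hp : p 3 = t * p 0) (hc : p ∈ cone) (hl : axisForm v t p = 0) (h0 : p ≠ 0) :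
    Φ.formγ t p ≠ 0 := by
  intro hγ
  have hα := Φ.formα_sq hn hp hc hl
  rw [hγ] at hα
  have hα' : Φ.formα t p = 0 := by
    refine pow_eq_zero_iff two_ne_zero |>.1 ?_
    rw [hα]; ring
  have z : ∀ i : Fin 3, p i.castSucc = 0 := by
    intro i
    have := Φ.m_mul hl i
    rw [hγ, hα', zero_mul, zero_mul, add_zero] at this
    exact (mul_eq_zero.1 this).resolve_left hm
  apply h0
  ext i
  fin_cases i
  · exact z 0
  · exact z 1
  · exact z 2
  · exact hp.trans (by rw [show p 0 = 0 from z 0, mul_zero]; rfl)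

theorem exists_eq_smul_pt {t : ℂ} {p : Fin 4 → ℂ} (hm : aeval t Φ.m ≠ 0) (hn : aeval t Φ.n ≠ 0)
    (hp : p 3 = t * p 0) (hc : p ∈ cone) (hl : axisForm v t p = 0) (h0 : p ≠ 0) :
    ∃ c r : ℂ, r ^ 2 = aeval t (qdisc v) ∧ p = c • Φ.pt t r := by
  have hγ := Φ.formγ_ne_zero hm hn hp hc hl h0
  refine ⟨Φ.formγ t p / aeval t Φ.m, Φ.formα t p / Φ.formγ t p, ?_, ?_⟩
  · rw [div_pow, Φ.formα_sq hn hp hc hl]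
    field_simp
  · have e0 := Φ.m_mul hl 0
    have e1 := Φ.m_mul hl 1
    have e2 := Φ.m_mul hl 2
    simp only [Fin.castSucc_zero, Fin.castSucc_one, show Fin.castSucc (2 : Fin 3) = 2 from rfl]
      at e0 e1 e2
    have z0 : p 0 = Φ.formγ t p / aeval t Φ.m * Φ.pt t (Φ.formα t p / Φ.formγ t p) 0 := by
      rw [pt_zero]
      field_simp
      linear_combination e0
    ext i
    fin_cases i
    · exact z0
    · change p 1 = _ * Φ.pt t _ 1
      rw [pt_one]
      field_simp
      linear_combination e1
    · change p 2 = _ * Φ.pt t _ 2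
      rw [pt_two]
      field_simp
      linear_combination e2
    · change p 3 = _ * Φ.pt t _ 3
      rw [pt_three, hp, z0]; ring

end Frame

/-- Substitution of the parametrization `a + r b`, where `r² = d`, into a polynomial gives a function
`x + r y` on the double cover of the base. -/
theorem exists_linear_in_root {k : Type} [CommRing k] [Algebra k ℂ] (a b : Fin 4 → k[X])
    (d : k[X]) (f : MvPolynomial (Fin 4) k[X]) :
    ∃ x y : k[X], ∀ t r : ℂ, r ^ 2 = aeval t d →
      f.eval₂ (evBase k t) (fun i => aeval t (a i) + r * aeval t (b i))
        = aeval t x + r * aeval t y := by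
  induction f using MvPolynomial.induction_on with
  | C c => exact ⟨c, 0, fun t r _ => by rw [MvPolynomial.eval₂_C, evBase_apply]; simp⟩
  | add p q hp hq =>
    obtain ⟨x, y, h⟩ := hp
    obtain ⟨x', y', h'⟩ := hq
    refine ⟨x + x', y + y', fun t r hr => ?_⟩
    rw [MvPolynomial.eval₂_add, h t r hr, h' t r hr, map_add, map_add]; ring
  | mul_X p i hp =>
    obtain ⟨x, y, h⟩ := hp
    refine ⟨x * a i + d * y * b i, x * b i + y * a i, fun t r hr => ?_⟩
    rw [MvPolynomial.eval₂_mul, MvPolynomial.eval₂_X, h t r hr]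
    simp only [map_add, map_mul]
    linear_combination aeval t y * aeval t (b i) * hr

theorem eq_zero_of_aeval_notMem {k : Type} [Field k] [Algebra k ℂ] {p : k[X]} (E : Finset ℂ)
    (h : ∀ t ∉ E, aeval t p = 0) : p = 0 := by
  have h1 : p.map (algebraMap k ℂ) = 0 := by
    refine Polynomial.eq_zero_of_infinite_isRoot _ ((Set.Finite.infinite_compl
      (Finset.finite_toSet E)).mono fun t ht => ?_)
    change eval t _ = 0
    rw [eval_map_algebraMap]
    exact h t (by simpa using ht)
  exact (Polynomial.map_eq_zero _).1 h1

/-- A function `x + r y` on the double cover `r² = d` vanishes if it does over general `t`. -/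
theorem eq_zero_of_root {k : Type} [Field k] [Algebra k ℂ] {x y d : k[X]} (hd : d ≠ 0)
    (E : Finset ℂ)
    (h : ∀ t ∉ E, ∀ r : ℂ, r ^ 2 = aeval t d → aeval t x + r * aeval t y = 0) :
    x = 0 ∧ y = 0 := by
  have key : ∀ t ∉ E, aeval t x = 0 ∧ aeval t (d * y) = 0 := by
    intro t ht
    obtain ⟨r, hr⟩ := IsAlgClosed.exists_pow_nat_eq (aeval t d) (n := 2) (by norm_num)
    -- The conjugate point `-r` of the double cover separates the two terms.
    have h1 := h t ht r hr
    have h2 := h t ht (-r) (by rw [neg_sq, hr])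
    refine ⟨by linear_combination (h1 + h2) / 2, ?_⟩
    rw [map_mul, ← hr]
    linear_combination r * (h1 - h2) / 2
  refine ⟨eq_zero_of_aeval_notMem E fun t ht => (key t ht).1, ?_⟩
  exact (mul_eq_zero.1 (eq_zero_of_aeval_notMem E fun t ht => (key t ht).2)).resolve_left hd

/-! ### The conics are irreducible -/

/-- The cone over the conic `Γ_t`. -/
def coneAt (t : ℂ) : Set (Fin 4 → ℂ) := {v | v ∈ cone ∧ v 3 = t * v 0}

/-- The parametrization of the cone over `Γ_t` by binary quadratic forms. -/
noncomputable def conicParam (t : ℂ) : Fin 4 → MvPolynomial (Fin 2) ℂ :=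
  ![MvPolynomial.X 0 * MvPolynomial.X 1,
    MvPolynomial.C (1 / 2) * (MvPolynomial.C (1 - t ^ 2) * MvPolynomial.X 0 ^ 2
      + MvPolynomial.X 1 ^ 2),
    MvPolynomial.C (-(Complex.I / 2)) * (MvPolynomial.C (1 - t ^ 2) * MvPolynomial.X 0 ^ 2
      - MvPolynomial.X 1 ^ 2),
    MvPolynomial.C t * (MvPolynomial.X 0 * MvPolynomial.X 1)]

theorem eval_conicParam (t : ℂ) (a : Fin 2 → ℂ) :
    (fun i => MvPolynomial.eval a (conicParam t i)) = ![a 0 * a 1,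
      ((1 - t ^ 2) * a 0 ^ 2 + a 1 ^ 2) / 2, -(Complex.I / 2) * ((1 - t ^ 2) * a 0 ^ 2 - a 1 ^ 2),
      t * (a 0 * a 1)] := by
  ext i
  fin_cases i <;> simp [conicParam]
  ring

theorem conicParam_mem (t : ℂ) (a : Fin 2 → ℂ) :
    (fun i => MvPolynomial.eval a (conicParam t i)) ∈ coneAt t := by
  rw [eval_conicParam]
  refine ⟨(mem_cone_iff (t := t) (by simp)).2 ?_, by simp⟩
  simp only [Matrix.cons_val_zero, Matrix.cons_val_one, Matrix.cons_val]
  linear_combination (((1 - t ^ 2) * a 0 ^ 2 - a 1 ^ 2) / 2) ^ 2 * Complex.I_sq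

theorem exists_conicParam {t : ℂ} (hd : 1 - t ^ 2 ≠ 0) {v : Fin 4 → ℂ} (hv : v ∈ coneAt t) :
    ∃ a : Fin 2 → ℂ, (fun i => MvPolynomial.eval a (conicParam t i)) = v := by
  obtain ⟨hc, h3⟩ := hv
  have hq := cone_mul_eq h3 hc
  obtain ⟨a, b, h0, hP, hV⟩ : ∃ a b : ℂ, v 0 = a * b ∧
      v 1 + Complex.I * v 2 = (1 - t ^ 2) * a ^ 2 ∧ v 1 - Complex.I * v 2 = b ^ 2 := by
    obtain ⟨b, hb⟩ := IsAlgClosed.exists_pow_nat_eq (v 1 - Complex.I * v 2) (n := 2) (by norm_num)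
    by_cases hb0 : b = 0
    · have hV : v 1 - Complex.I * v 2 = 0 := by rw [← hb, hb0]; ring
      rw [hV, mul_zero] at hq
      have h0 : v 0 = 0 :=
        pow_eq_zero_iff two_ne_zero |>.1 ((mul_eq_zero.1 hq.symm).resolve_left hd)
      obtain ⟨a, ha⟩ := IsAlgClosed.exists_pow_nat_eq
        ((v 1 + Complex.I * v 2) / (1 - t ^ 2)) (n := 2) (by norm_num)
      exact ⟨a, b, by rw [h0, hb0, mul_zero], by rw [ha]; field_simp, hb.symm⟩
    · refine ⟨v 0 / b, b, by field_simp, ?_, hb.symm⟩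
      rw [← hb] at hq
      field_simp
      linear_combination hq
  refine ⟨![a, b], ?_⟩
  rw [eval_conicParam]
  have hI := Complex.I_sq
  ext i
  fin_cases i <;> simp only [Matrix.cons_val_zero, Matrix.cons_val_one, Matrix.cons_val,
    Fin.zero_eta, Fin.mk_one, Fin.reduceFinMk]
  · exact h0.symm
  · linear_combination -(hP + hV) / 2
  · linear_combination (Complex.I / 2) * (hP - hV) - v 2 * hI
  · rw [h3, h0]

/-- The conic `Γ_t` is irreducible for `t ≠ ±1`, as the image of `ℙ¹`. -/
theorem vanish_of_mul_conic {t : ℂ} (hd : 1 - t ^ 2 ≠ 0) {f g : MvPolynomial (Fin 4) ℂ}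
    (h : ∀ v ∈ coneAt t, MvPolynomial.eval v f * MvPolynomial.eval v g = 0) :
    (∀ v ∈ coneAt t, MvPolynomial.eval v f = 0) ∨
      (∀ v ∈ coneAt t, MvPolynomial.eval v g = 0) := by
  have conv : ∀ (q : MvPolynomial (Fin 4) ℂ) (a : Fin 2 → ℂ),
      MvPolynomial.eval a (MvPolynomial.aeval (conicParam t) q)
        = MvPolynomial.eval (fun i => MvPolynomial.eval a (conicParam t i)) q := by
    intro q a
    induction q using MvPolynomial.induction_on with
    | C r => simp [MvPolynomial.algebraMap_eq]
    | add p q hp hq => simp only [map_add, hp, hq]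
    | mul_X p i hp => simp only [map_mul, hp, MvPolynomial.aeval_X, MvPolynomial.eval_X]
  have h0 : MvPolynomial.aeval (conicParam t) f * MvPolynomial.aeval (conicParam t) g = 0 := by
    apply MvPolynomial.funext
    intro a
    rw [map_mul, conv, conv, map_zero]
    exact h _ (conicParam_mem t a)
  have fin : ∀ q : MvPolynomial (Fin 4) ℂ, MvPolynomial.aeval (conicParam t) q = 0 →
      ∀ v ∈ coneAt t, MvPolynomial.eval v q = 0 := by
    intro q hq v hv
    obtain ⟨a, rfl⟩ := exists_conicParam hd hv
    rw [← conv, hq, map_zero]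
  exact (mul_eq_zero.1 h0).imp (fin f) (fin g)

/-! ### Fixed points of half-turns -/

/-- The linear forms in the coordinates of `ℙ³`, with coefficients in `ℝ[t]`, that give a
rotation. -/
noncomputable def rotLin (h : Quat) : Fin 4 → MvPolynomial (Fin 4) ℝ[X] :=
  let L : Fin 3 → MvPolynomial (Fin 4) ℝ[X] := fun i =>
    ∑ j : Fin 3, MvPolynomial.C (rotMatrix h i j) * MvPolynomial.X j.castSucc
  ![L 0, L 1, L 2, MvPolynomial.C X * L 0]

theorem rotLin_isHomogeneous (h : Quat) (i : Fin 4) : (rotLin h i).IsHomogeneous 1 := by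
  have key : ∀ i : Fin 3, (∑ j : Fin 3, MvPolynomial.C (rotMatrix h i j)
      * MvPolynomial.X j.castSucc : MvPolynomial (Fin 4) ℝ[X]).IsHomogeneous 1 := fun i =>
    MvPolynomial.IsHomogeneous.sum _ _ _ fun j _ => (MvPolynomial.isHomogeneous_X _ _).C_mul _
  fin_cases i
  · exact key 0
  · exact key 1
  · exact key 2
  · exact (key 0).C_mul _

theorem eval₂_rotLin (h : Quat) (t : ℂ) (p : Fin 4 → ℂ) (i : Fin 4) :
    (rotLin h i).eval₂ (evBase ℝ t) p = act h t p i := by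
  fin_cases i <;> simp [rotLin, act, Matrix.mulVec, dotProduct, Fin.sum_univ_three,
    MvPolynomial.eval₂_add, MvPolynomial.eval₂_mul, Polynomial.aeval_def]

theorem rep_mem_coneAt {t : ℂ} {p : ℙ ℂ (Fin 4 → ℂ)} (hp : p ∈ fibre t) : p.rep ∈ coneAt t := hp

theorem exists_fibre_point (t : ℂ) : ∃ w : Fin 4 → ℂ, w ∈ coneAt t ∧ w 0 = 1 ∧ w ≠ 0 := by
  obtain ⟨x, hx⟩ := exists_point t
  refine ⟨_, ⟨hx 1 (by norm_num), by simp⟩, by simp, fun h => ?_⟩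
  have := congrFun h 0
  simp at this

/-- A point of a general conic is fixed by the restriction of a half-turn if and only if it lies on
the polar of the axis. -/
theorem restrictionMaps_iff {v : Quat} (hv : v.re = 0) (h0 : v ≠ 0) {t : ℂ}
    (hd : 1 - t ^ 2 ≠ 0) (hN : aeval t (qdisc v) ≠ 0) {p : ℙ ℂ (Fin 4 → ℂ)} (hp : p ∈ fibre t) :
    RestrictionMaps (rotBir v h0).1 t p p ↔ axisForm v t p.rep = 0 := by
  have hN' : aeval t (qnorm v) ≠ 0 := by rwa [qnorm_of_pure hv, map_neg, neg_ne_zero]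
  constructor
  · rintro ⟨F, hF, ⟨r, hr, hFr⟩, G, d, hG, hprop, hne, hmk⟩
    have hsame : DomRep.Same F (rotRep v h0) := same_of_represents hF (represents_rotBir h0)
    -- Along the conic, the forms `G` are proportional to the rotation.
    have key : ∀ i j, evPt G p i * act v t p.rep j = evPt G p j * act v t p.rep i := by
      intro i j
      let A : Fin 4 → MvPolynomial (Fin 4) ℂ := fun i => MvPolynomial.map (evBase ℝ t) (rotLin v i)
      have hA : ∀ w i, MvPolynomial.eval w (A i) = act v t w i := fun w i => by
        rw [← eval₂_rotLin, MvPolynomial.eval_map]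
      obtain ⟨k, hk⟩ := Function.ne_iff.1 hFr
      let Fk : MvPolynomial (Fin 4) ℂ := MvPolynomial.map (algebraMap ℝ ℂ) (F.forms k)
      have hFk : ∀ w, MvPolynomial.eval w Fk = ev F.forms w k := fun w => by
        rw [MvPolynomial.eval_map]; rfl
      -- The proportionality is known off the zeros of `w` and of one of the forms of `F`, which
      -- suffices, as the conic is irreducible.
      have van : ∀ w ∈ coneAt t, MvPolynomial.eval w (G i * A j - G j * A i)
          * MvPolynomial.eval w (MvPolynomial.X 0 * Fk) = 0 := by
        intro w hw
        simp only [map_sub, map_mul, MvPolynomial.eval_X, hA, hFk]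
        by_cases hw0 : w 0 = 0
        · rw [hw0]; ring
        have hwne : w ≠ 0 := fun h => hw0 (by rw [h]; rfl)
        obtain ⟨c, hc, e⟩ := exists_rep_smul hwne
        have e' : w = c⁻¹ • (Projectivization.mk ℂ w hwne).rep := by
          rw [e, smul_smul, inv_mul_cancel₀ hc, one_smul]
        have hr' := hprop _ ((mk_mem_fibre hwne).2 hw)
        have gw : ∀ i, MvPolynomial.eval w (G i)
            = c⁻¹ ^ d * evPt G (Projectivization.mk ℂ w hwne) i := by
          intro i
          conv_lhs => rw [e']
          exact eval₂_smul_of_isHomogeneous (RingHom.id ℂ) (hG i) _ _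
        have fw : ∀ i, ev F.forms w i
            = c⁻¹ ^ F.deg * ev F.forms (Projectivization.mk ℂ w hwne).rep i := by
          intro i
          conv_lhs => rw [e', ev_smul F.homog]
          rfl
        have g1 : ∀ i j, MvPolynomial.eval w (G i) * ev F.forms w j
            = MvPolynomial.eval w (G j) * ev F.forms w i := by
          intro i j
          rw [gw, gw, fw, fw]
          linear_combination c⁻¹ ^ d * c⁻¹ ^ F.deg * hr' i j
        have f1 : ∀ i j, ev F.forms w i * act v t w j = ev F.forms w j * act v t w i := by
          intro i j
          have := hsame w hw.1 i j
          rw [ev_rotRep h0 hw.2] at this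
          simp only [Pi.smul_apply, smul_eq_mul] at this
          exact mul_left_cancel₀ (pow_ne_zero (rotDeg v + 1) hw0) (by linear_combination this)
        linear_combination w 0 * (act v t w j * g1 i k - act v t w i * g1 j k
          + MvPolynomial.eval w (G k) * f1 i j)
      have h1 := (vanish_of_mul_conic hd van).resolve_right fun h => by
        rcases vanish_of_mul_conic hd (f := MvPolynomial.X 0) (g := Fk)
          (fun w hw => by rw [← map_mul]; exact h w hw) with h | h
        · obtain ⟨w, hw, hw0, -⟩ := exists_fibre_point t
          have := h w hw
          rw [MvPolynomial.eval_X, hw0] at this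
          exact one_ne_zero this
        · exact hk (by rw [← hFk]; exact h _ (rep_mem_coneAt hr))
      have h2 := h1 _ (rep_mem_coneAt hp)
      simp only [map_sub, map_mul, hA] at h2
      exact sub_eq_zero.1 h2
    obtain ⟨c, hc⟩ := (Projectivization.mk_eq_mk_iff' ℂ _ _ hne p.rep_nonzero).1
      (hmk.trans p.mk_rep.symm)
    have hc0 : c ≠ 0 := by
      rintro rfl
      exact hne (by rw [← hc, zero_smul])
    refine axisForm_eq_zero hv hp.2 hp.1 p.rep_nonzero hd hN fun i j => ?_
    have := key i j
    rw [← hc] at this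
    simp only [Pi.smul_apply, smul_eq_mul] at this
    exact mul_left_cancel₀ hc0 (by linear_combination -this)
  · intro hl
    obtain ⟨w, hw, hw0, hwne⟩ := exists_fibre_point t
    have hact : act v t p.rep = aeval t (qdisc v) • p.rep := by
      rw [act_pure hv hp.2, hl, mul_zero, zero_smul, add_zero]
    have hG : evPt (fun i => MvPolynomial.map (evBase ℝ t) (rotLin v i)) p = act v t p.rep := by
      ext i
      rw [evPt, MvPolynomial.eval_map, eval₂_rotLin]
    have hne : evPt (fun i => MvPolynomial.map (evBase ℝ t) (rotLin v i)) p ≠ 0 := by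
      rw [hG, hact]
      exact smul_ne_zero hN p.rep_nonzero
    refine ⟨rotRep v h0, represents_rotBir h0, ⟨Projectivization.mk ℂ w hwne,
      (mk_mem_fibre hwne).2 hw, ?_⟩, fun i => MvPolynomial.map (evBase ℝ t) (rotLin v i), 1,
      fun i => (rotLin_isHomogeneous v i).map _, fun r hr i j => ?_, hne, ?_⟩
    · obtain ⟨c, hc, e⟩ := exists_rep_smul hwne
      have h3 := ((mk_mem_fibre hwne).2 hw).2
      rw [ev_rotRep h0 h3]
      refine smul_ne_zero (pow_ne_zero _ ?_) (act_ne_zero v h3 hN' (Projectivization.rep_nonzero _))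
      rw [e, Pi.smul_apply, hw0, smul_eq_mul, mul_one]
      exact hc
    · rw [ev_rotRep h0 hr.2]
      simp only [evPt, MvPolynomial.eval_map, eval₂_rotLin, Pi.smul_apply, smul_eq_mul]
      ring
    · refine Eq.trans ?_ p.mk_rep
      rw [Projectivization.mk_eq_mk_iff']
      exact ⟨aeval t (qdisc v), by rw [hG, hact]⟩

/-- The complex zeros of a polynomial. -/
noncomputable def zeros (p : ℝ[X]) : Finset ℂ := (p.aroots ℂ).toFinset

theorem aeval_ne_zero_of_notMem {p : ℝ[X]} (hp : p ≠ 0) {t : ℂ} (ht : t ∉ zeros p) :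
    aeval t p ≠ 0 := fun h => ht (by simp [zeros, hp, h])

/-- The values of `t` that are not general for a frame. -/
noncomputable def Frame.bad {v : Quat} (Φ : Frame v) : Finset ℂ :=
  zeros ((1 - X ^ 2) * qdisc v * (Φ.m * Φ.n))

theorem Frame.of_notMem_bad {v : Quat} (hv : v.re = 0) (h0 : v ≠ 0) (Φ : Frame v) {t : ℂ}
    (ht : t ∉ Φ.bad) : 1 - t ^ 2 ≠ 0 ∧ aeval t (qdisc v) ≠ 0 ∧ aeval t Φ.m ≠ 0 ∧
      aeval t Φ.n ≠ 0 := by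
  have := aeval_ne_zero_of_notMem (mul_ne_zero (mul_ne_zero one_sub_sq_ne_zero
    (qdisc_ne_zero hv h0)) (mul_ne_zero Φ.m_ne Φ.n_ne)) ht
  simp only [map_mul, map_sub, map_one, map_pow, aeval_X, mul_ne_zero_iff] at this
  exact ⟨this.1.1, this.1.2, this.2.1, this.2.2⟩

theorem mem_fixedPointsOff_iff {v : Quat} (hv : v.re = 0) (h0 : v ≠ 0) (Φ : Frame v)
    {E : Finset ℂ} {P : Pt} (hP : P.2 ∉ Φ.bad) :
    P ∈ fixedPointsOff (rotBir v h0).1 E ↔ P.2 ∉ E ∧ P ∈ polarCurve v := by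
  obtain ⟨hd, hN, -, -⟩ := Φ.of_notMem_bad hv h0 hP
  simp only [fixedPointsOff, polarCurve, Set.mem_ofPred_eq]
  refine and_congr_right fun _ => and_congr_right fun hf => restrictionMaps_iff hv h0 hd hN hf

theorem fixedPointsOff_eq {v : Quat} (hv : v.re = 0) (h0 : v ≠ 0) (Φ : Frame v)
    {E : Finset ℂ} (hE : Φ.bad ⊆ E) :
    fixedPointsOff (rotBir v h0).1 E = {P | P.2 ∉ E ∧ P ∈ polarCurve v} := by
  ext P
  constructor
  · intro h
    exact (mem_fixedPointsOff_iff hv h0 Φ fun hb => h.1 (hE hb)).1 h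
  · rintro ⟨h1, h2⟩
    exact (mem_fixedPointsOff_iff hv h0 Φ fun hb => h1 (hE hb)).2 ⟨h1, h2⟩

theorem fixedCurve_subset {v : Quat} (hv : v.re = 0) (h0 : v ≠ 0) (Φ : Frame v) :
    fixedCurve (rotBir v h0).1 ⊆ polarCurve v := by
  refine (Set.iInter_subset _ Φ.bad).trans
    (zariskiClosure_subset (isZariskiClosed_polarCurve v) ?_)
  rw [fixedPointsOff_eq hv h0 Φ subset_rfl]
  exact fun P hP => hP.2

/-- Over general `t` the curve of fixed points is the polar curve: a form that vanishes on the
polar curve over almost all `t` vanishes over all of them, by the parametrization. -/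
theorem mem_fixedCurve {v : Quat} (hv : v.re = 0) (h0 : v ≠ 0) (Φ : Frame v)
    {P : Pt} (hP : P ∈ polarCurve v) (hb : P.2 ∉ Φ.bad) :
    P ∈ fixedCurve (rotBir v h0).1 := by
  refine Set.mem_iInter.2 fun E => Set.mem_sInter.2 ?_
  rintro _ ⟨⟨s, hs, rfl⟩, hsub⟩ f hf
  obtain ⟨d, hfd⟩ := hs f hf
  obtain ⟨x, y, hxy⟩ := exists_linear_in_root (k := ℂ)
    (fun i => (Φ.base i).map (algebraMap ℝ ℂ)) (fun i => (Φ.dir i).map (algebraMap ℝ ℂ))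
    ((qdisc v).map (algebraMap ℝ ℂ)) f
  simp only [aeval_map_algebraMap] at hxy
  have hd0 : (qdisc v).map (algebraMap ℝ ℂ) ≠ 0 :=
    (Polynomial.map_ne_zero_iff (algebraMap ℝ ℂ).injective).2 (qdisc_ne_zero hv h0)
  obtain ⟨rfl, rfl⟩ := eq_zero_of_root (x := x) (y := y) hd0 (E ∪ Φ.bad) (fun t ht r hr => by
    rw [aeval_map_algebraMap] at hr
    rw [Finset.mem_union, not_or] at ht
    obtain ⟨-, -, hm, -⟩ := Φ.of_notMem_bad hv h0 ht.2
    rw [← hxy t r hr]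
    have hne := Φ.pt_ne_zero hm r
    have hmem : ((Projectivization.mk ℂ (Φ.pt t r) hne, t) : Pt) ∈ polarCurve v :=
      (mk_mem_polarCurve hne).2 ⟨Φ.pt_mem_cone hr, Φ.pt_three t r, Φ.axisForm_pt t r⟩
    exact (value_mk hfd hne t).1
      (hsub ((mem_fixedPointsOff_iff hv h0 Φ ht.2).2 ⟨ht.1, hmem⟩) f hf))
  obtain ⟨-, -, hm, hn⟩ := Φ.of_notMem_bad hv h0 hb
  obtain ⟨c, r, hr, hc⟩ := Φ.exists_eq_smul_pt hm hn hP.1.2 hP.1.1 hP.2 P.1.rep_nonzero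
  have h1 := hxy P.2 r hr
  simp only [map_zero, mul_zero, add_zero] at h1
  change MvPolynomial.eval₂ _ _ _ = 0
  rw [hc, eval₂_smul_of_isHomogeneous _ hfd]
  exact mul_eq_zero_of_right _ h1

theorem exists_form_of_finset (E : Finset ℂ) : ∃ f : MvPolynomial (Fin 4) ℂ[X],
    f.IsHomogeneous 0 ∧ ∀ P : Pt, value f P = 0 ↔ P.2 ∈ E := by
  refine ⟨MvPolynomial.C (∏ e ∈ E, (X - C e)), MvPolynomial.isHomogeneous_C _ _, fun P => ?_⟩
  rw [value, MvPolynomial.eval₂_C, evBase_apply, map_prod, Finset.prod_eq_zero_iff]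
  simp [sub_eq_zero]

/-- The part of the curve of fixed points over the complement of a finite set is dense in it. -/
theorem isDenseOpenIn_fixedCurve {v : Quat} (hv : v.re = 0) (h0 : v ≠ 0) (Φ : Frame v)
    {E : Finset ℂ} (hE : Φ.bad ⊆ E) :
    IsDenseOpenIn {P | P.2 ∉ E ∧ P ∈ polarCurve v} (fixedCurve (rotBir v h0).1) := by
  obtain ⟨f, hf, hval⟩ := exists_form_of_finset E
  refine ⟨⟨{P | value f P = 0}, isZariskiClosed_zeroLocus hf, ?_⟩, ?_⟩
  · ext P
    simp only [Set.mem_ofPred_eq, Set.mem_sdiff, hval]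
    constructor
    · rintro ⟨h1, h2⟩
      exact ⟨mem_fixedCurve hv h0 Φ h2 fun hb => h1 (hE hb), h1⟩
    · rintro ⟨h1, h2⟩
      exact ⟨h2, fixedCurve_subset hv h0 Φ h1⟩
  · rw [← fixedPointsOff_eq hv h0 Φ hE]
    exact Set.iInter_subset _ E

/-! ### Conjugate half-turns have birational curves of fixed points -/

/-- Quaternions that give the same rotation are proportional. -/
theorem exists_scalar_of_rotBir_eq {h k : Quat} (hh : h ≠ 0) (hk : k ≠ 0)
    (e : rotBir h hh = rotBir k hk) : ∃ s : ℝ[X], s ≠ 0 ∧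
      ((qnorm k : ℝ[X]) : Quat) * h = (s : Quat) * k := by
  have hs := star_ne_zero' hk
  have h1 : rotBir (h * star k) (quat_mul_ne_zero hh hs) = 1 := by
    rw [← rotBir_mul hh hs, e, rotBir_mul, rotBir_congr _ (coe_quat_ne_zero (qnorm_ne_zero hk))
      (mul_star_eq k), rotBir_coe]
  obtain ⟨e1, e2, e3⟩ := im_eq_zero_of_rotBir_eq_one _ h1
  have hc : h * star k = (((h * star k).re : ℝ[X]) : Quat) := by
    ext1
    · rfl
    · exact e1
    · exact e2
    · exact e3
  have key : ((qnorm k : ℝ[X]) : Quat) * h = (((h * star k).re : ℝ[X]) : Quat) * k := by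
    rw [← hc, mul_assoc, star_mul_eq, QuaternionAlgebra.coe_commutes]
  refine ⟨(h * star k).re, fun h0 => ?_, key⟩
  exact quat_mul_ne_zero hh hs (by rw [hc, h0, QuaternionAlgebra.coe_zero])

theorem act_coe_mul (c : ℝ[X]) (h : Quat) (t : ℂ) (p : Fin 4 → ℂ) :
    act ((c : Quat) * h) t p = aeval t c ^ 2 • act h t p := by
  rw [act_mul, act_coe c (act_three h t p)]

/-- A rotation that conjugates two half-turns maps, over general `t`, the fixed points of the first
one to fixed points of the second one. -/
theorem exists_finset_act_mem {a b k : Quat} (ha : a.re = 0) (hb : b.re = 0) (ha0 : a ≠ 0)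
    (hb0 : b ≠ 0) (hk : k ≠ 0)
    (hc : rotBir k hk * rotBir a ha0 = rotBir b hb0 * rotBir k hk) :
    ∃ E : Finset ℂ, ∀ t ∉ E, aeval t (qnorm k) ≠ 0 ∧ ∀ p : Fin 4 → ℂ, p ≠ 0 → p ∈ cone →
      p 3 = t * p 0 → axisForm a t p = 0 →
      act k t p ≠ 0 ∧ act k t p ∈ cone ∧ axisForm b t (act k t p) = 0 := by
  rw [rotBir_mul, rotBir_mul] at hc
  obtain ⟨s, hs, e⟩ := exists_scalar_of_rotBir_eq _ _ hc
  refine ⟨zeros ((1 - X ^ 2) * qdisc b * (qnorm k * s)), fun t ht => ?_⟩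
  have := aeval_ne_zero_of_notMem (mul_ne_zero (mul_ne_zero one_sub_sq_ne_zero
    (qdisc_ne_zero hb hb0)) (mul_ne_zero (qnorm_ne_zero hk) hs)) ht
  simp only [map_mul, map_sub, map_one, map_pow, aeval_X, mul_ne_zero_iff] at this
  obtain ⟨⟨hd, hN⟩, hk', hs'⟩ := this
  refine ⟨hk', fun p hp0 hpc hp hl => ?_⟩
  have hne := act_ne_zero k hp hk' hp0
  refine ⟨hne, act_mem_cone k hp hpc, ?_⟩
  refine axisForm_eq_zero hb (act_three k t p) (act_mem_cone k hp hpc) hne hd hN fun i j => ?_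
  have h1 := congrArg (fun q : Quat => act q t p) e
  simp only [act_coe_mul] at h1
  rw [act_mul, act_mul, act_pure ha hp, hl, mul_zero, zero_smul, add_zero, act_smul] at h1
  have hi := congrFun h1 i
  have hj := congrFun h1 j
  simp only [Pi.smul_apply, smul_eq_mul] at hi hj
  refine mul_left_cancel₀ (pow_ne_zero 2 hs') ?_
  linear_combination act k t p i * hj - act k t p j * hi

theorem realValue_rotLin (k : Quat) (P : Pt) : realValue (rotLin k) P = act k P.2 P.1.rep := by
  ext i
  exact eval₂_rotLin k P.2 P.1.rep i

theorem mapsOver_rotLin {a b k : Quat} {E E' : Finset ℂ} (hE : E' ⊆ E)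
    (h : ∀ t ∉ E', aeval t (qnorm k) ≠ 0 ∧ ∀ p : Fin 4 → ℂ, p ≠ 0 → p ∈ cone →
      p 3 = t * p 0 → axisForm a t p = 0 →
      act k t p ≠ 0 ∧ act k t p ∈ cone ∧ axisForm b t (act k t p) = 0) :
    MapsOver (rotLin k) {P | P.2 ∉ E ∧ P ∈ polarCurve a} {P | P.2 ∉ E ∧ P ∈ polarCurve b} := by
  rintro P ⟨hP, hPa⟩
  obtain ⟨h1, h2, h3⟩ := (h P.2 fun h' => hP (hE h')).2 P.1.rep P.1.rep_nonzero hPa.1.1 hPa.1.2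
    hPa.2
  have hne : realValue (rotLin k) P ≠ 0 := by rwa [realValue_rotLin]
  refine ⟨hne, hP, ?_⟩
  rw [mk_mem_polarCurve hne, realValue_rotLin]
  exact ⟨h2, act_three _ _ _, h3⟩

theorem invertsOn_rotLin {a k l : Quat} (hlk : l * k = ((qnorm k : ℝ[X]) : Quat)) {E : Finset ℂ}
    (hE : ∀ t ∉ E, aeval t (qnorm k) ≠ 0) :
    InvertsOn (rotLin l) (rotLin k) {P | P.2 ∉ E ∧ P ∈ polarCurve a} := by
  rintro P ⟨hP, hPa⟩ hne
  obtain ⟨c, hc, e⟩ := exists_rep_smul hne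
  have key : realValue (rotLin l) (Projectivization.mk ℂ (realValue (rotLin k) P) hne, P.2)
      = (c * aeval P.2 (qnorm k) ^ 2) • P.1.rep := by
    rw [realValue_rotLin]
    simp only [e]
    rw [act_smul, realValue_rotLin, ← act_mul, hlk, act_coe _ hPa.1.2, smul_smul]
  have h' : realValue (rotLin l) (Projectivization.mk ℂ (realValue (rotLin k) P) hne, P.2) ≠ 0 := by
    rw [key]
    exact smul_ne_zero (mul_ne_zero hc (pow_ne_zero 2 (hE _ hP))) P.1.rep_nonzero
  refine ⟨h', Eq.trans ?_ P.1.mk_rep⟩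
  rw [Projectivization.mk_eq_mk_iff']
  exact ⟨_, key.symm⟩

/-- A rotation that conjugates two half-turns restricts to a birational map between their curves of
fixed points, with the rotation by the conjugate quaternion as inverse. -/
theorem realBirational_of_isConj {a b : Quat} (ha : a.re = 0) (hb : b.re = 0) (ha0 : a ≠ 0)
    (hb0 : b ≠ 0) (h : IsConj (rotBir a ha0) (rotBir b hb0)) :
    RealBirationalOverBase (fixedCurve (rotBir a ha0).1) (fixedCurve (rotBir b hb0).1) := by
  obtain ⟨c, hc⟩ := isConj_iff.1 h
  obtain ⟨k, hk, rfl⟩ := exists_rotBir c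
  obtain ⟨Φ⟩ := exists_frame ha ha0
  obtain ⟨Ψ⟩ := exists_frame hb hb0
  have hc1 : rotBir k hk * rotBir a ha0 = rotBir b hb0 * rotBir k hk := by
    rw [← hc, inv_mul_cancel_right]
  have hinv : rotBir (star k) (star_ne_zero' hk) = (rotBir k hk)⁻¹ := by
    rw [eq_inv_iff_mul_eq_one, rotBir_mul, rotBir_congr _
      (coe_quat_ne_zero (qnorm_ne_zero hk)) (star_mul_eq k), rotBir_coe]
  have hc2 : rotBir (star k) (star_ne_zero' hk) * rotBir b hb0
      = rotBir a ha0 * rotBir (star k) (star_ne_zero' hk) := by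
    rw [hinv, ← hc]; group
  obtain ⟨E₁, h₁⟩ := exists_finset_act_mem ha hb ha0 hb0 hk hc1
  obtain ⟨E₂, h₂⟩ := exists_finset_act_mem hb ha hb0 ha0 (star_ne_zero' hk) hc2
  let E := (Φ.bad ∪ Ψ.bad) ∪ (E₁ ∪ E₂)
  have hΦ : Φ.bad ⊆ E := fun x hx => Finset.mem_union_left _ (Finset.mem_union_left _ hx)
  have hΨ : Ψ.bad ⊆ E := fun x hx => Finset.mem_union_left _ (Finset.mem_union_right _ hx)
  have hE₁ : E₁ ⊆ E := fun x hx => Finset.mem_union_right _ (Finset.mem_union_left _ hx)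
  have hE₂ : E₂ ⊆ E := fun x hx => Finset.mem_union_right _ (Finset.mem_union_right _ hx)
  refine ⟨_, _, isDenseOpenIn_fixedCurve ha ha0 Φ hΦ, isDenseOpenIn_fixedCurve hb hb0 Ψ hΨ,
    rotLin k, rotLin (star k), ⟨1, rotLin_isHomogeneous k⟩, ⟨1, rotLin_isHomogeneous _⟩,
    mapsOver_rotLin hE₁ h₁, mapsOver_rotLin hE₂ h₂,
    invertsOn_rotLin (star_mul_eq k) fun t ht => (h₁ t fun h' => ht (hE₁ h')).1,
    invertsOn_rotLin ?_ fun t ht => (h₂ t fun h' => ht (hE₂ h')).1⟩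
  rw [mul_star_eq, qnorm_star]

/-! ### Half-turns with birational curves of fixed points are conjugate -/

/-- The square of a nonzero pure quaternion `a` is not a square of a rational function, because
`x² - a² y²` is the norm of `x + y a`. -/
theorem eq_zero_of_sq_eq {a : Quat} (ha : a.re = 0) (ha0 : a ≠ 0) {x y : ℝ[X]}
    (h : x ^ 2 - qdisc a * y ^ 2 = 0) : x = 0 ∧ y = 0 := by
  have h1 : (⟨x, y * a.imI, y * a.imJ, y * a.imK⟩ : Quat) = 0 := by
    apply eq_zero_of_qnorm
    rw [qdisc] at h
    rw [qnorm]
    linear_combination h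
  refine ⟨congrArg QuaternionAlgebra.re h1, ?_⟩
  by_contra hy
  apply ha0
  ext1
  · exact ha
  · exact (mul_eq_zero.1 (congrArg QuaternionAlgebra.imI h1)).resolve_left hy
  · exact (mul_eq_zero.1 (congrArg QuaternionAlgebra.imJ h1)).resolve_left hy
  · exact (mul_eq_zero.1 (congrArg QuaternionAlgebra.imK h1)).resolve_left hy

theorem mul_self_of_pure {v : Quat} (hv : v.re = 0) : v * v = ((qdisc v : ℝ[X]) : Quat) := by
  ext1 <;> simp only [QuaternionAlgebra.re_coe, QuaternionAlgebra.imI_coe,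
    QuaternionAlgebra.imJ_coe, QuaternionAlgebra.imK_coe] <;> simp [qdisc, hv] <;> ring

/-- Pure quaternions whose squares differ by the square of a rational function give conjugate
half-turns: if `a² = b²`, then `(a + b) a = b (a + b)`. -/
theorem isConj_of_qdisc {a b : Quat} (ha : a.re = 0) (hb : b.re = 0) (ha0 : a ≠ 0)
    (hb0 : b ≠ 0) {x y : ℝ[X]} (hx : x ≠ 0) (hy : y ≠ 0)
    (h : qdisc a * x ^ 2 = qdisc b * y ^ 2) : IsConj (rotBir a ha0) (rotBir b hb0) := by
  set a' : Quat := (x : Quat) * a with ha'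
  set b' : Quat := (y : Quat) * b with hb'
  have ha'0 : a' ≠ 0 := quat_mul_ne_zero (coe_quat_ne_zero hx) ha0
  have hb'0 : b' ≠ 0 := quat_mul_ne_zero (coe_quat_ne_zero hy) hb0
  have sq : ∀ (c : ℝ[X]) {v : Quat}, v.re = 0 →
      ((c : Quat) * v) * ((c : Quat) * v) = ((qdisc v * c ^ 2 : ℝ[X]) : Quat) := by
    intro c v hv
    rw [mul_assoc, ← mul_assoc v, ← QuaternionAlgebra.coe_commutes c v, mul_assoc (c : Quat) v v,
      mul_self_of_pure hv, ← QuaternionAlgebra.coe_mul, ← QuaternionAlgebra.coe_mul]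
    congr 1
    ring
  have hsq : a' * a' = b' * b' := by rw [ha', hb', sq x ha, sq y hb, h]
  have hra : rotBir a' ha'0 = rotBir a ha0 := rotBir_coe_mul ha0 ha'0
  have hrb : rotBir b' hb'0 = rotBir b hb0 := rotBir_coe_mul hb0 hb'0
  rw [← hra, ← hrb]
  -- If `a + b = 0`, then `a` and `b` give the same rotation.
  by_cases hs : a' + b' = 0
  · have e : b' = ((-1 : ℝ[X]) : Quat) * a' := by
      rw [QuaternionAlgebra.coe_neg, QuaternionAlgebra.coe_one, neg_one_mul]
      exact eq_neg_of_add_eq_zero_right hs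
    have hne : ((-1 : ℝ[X]) : Quat) * a' ≠ 0 := e ▸ hb'0
    rw [rotBir_congr hb'0 hne e, rotBir_coe_mul ha'0 hne]
  · refine isConj_iff.2 ⟨rotBir (a' + b') hs, ?_⟩
    rw [mul_inv_eq_iff_eq_mul, rotBir_mul, rotBir_mul]
    refine rotBir_congr _ _ ?_
    rw [add_mul, mul_add, hsq, add_comm]

/-- The form obtained by substituting a map over the base into a linear form in `w, x, y`. -/
noncomputable def pullForm (H : Fin 4 → MvPolynomial (Fin 4) ℝ[X]) (c : Fin 3 → ℝ[X]) :
    MvPolynomial (Fin 4) ℝ[X] :=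
  MvPolynomial.C (c 0) * H 0 + MvPolynomial.C (c 1) * H 1 + MvPolynomial.C (c 2) * H 2

theorem pullForm_isHomogeneous {H : Fin 4 → MvPolynomial (Fin 4) ℝ[X]} {d : ℕ}
    (hH : ∀ i, (H i).IsHomogeneous d) (c : Fin 3 → ℝ[X]) : (pullForm H c).IsHomogeneous d :=
  (((hH 0).C_mul _).add ((hH 1).C_mul _)).add ((hH 2).C_mul _)

theorem value_pullForm (H : Fin 4 → MvPolynomial (Fin 4) ℝ[X]) (c : Fin 3 → ℝ[X]) (P : Pt) :
    value (pullForm H c) P = aeval P.2 (c 0) * realValue H P 0 + aeval P.2 (c 1) * realValue H P 1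
      + aeval P.2 (c 2) * realValue H P 2 := by
  simp only [value, pullForm, MvPolynomial.eval₂_add, MvPolynomial.eval₂_mul,
    MvPolynomial.eval₂_C, evBase_apply, realValue]

/-- A rational map over the base between the curves of fixed points embeds the function field of
the second curve into that of the first one, so that the classes of `a²` and `b²` modulo squares
agree. -/
theorem exists_qdisc_mul_sq {a b : Quat} (ha : a.re = 0) (hb : b.re = 0) (ha0 : a ≠ 0)
    (hb0 : b ≠ 0) {U U' : Set Pt} (hU : fixedCurve (rotBir a ha0).1 ⊆ zariskiClosure U)
    (hUa : U ⊆ fixedCurve (rotBir a ha0).1) (hU' : U' ⊆ fixedCurve (rotBir b hb0).1)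
    {H : Fin 4 → MvPolynomial (Fin 4) ℝ[X]} {d : ℕ} (hH : ∀ i, (H i).IsHomogeneous d)
    (hmap : MapsOver H U U') :
    ∃ x y : ℝ[X], x ≠ 0 ∧ y ≠ 0 ∧ qdisc a * x ^ 2 = qdisc b * y ^ 2 := by
  obtain ⟨Φ⟩ := exists_frame ha ha0
  obtain ⟨Ψ⟩ := exists_frame hb hb0
  set e : ℝ[X] := ((1 - X ^ 2) * qdisc a * (Φ.m * Φ.n)) * ((1 - X ^ 2) * qdisc b * (Ψ.m * Ψ.n))
    with he
  have he0 : e ≠ 0 := mul_ne_zero (mul_ne_zero (mul_ne_zero one_sub_sq_ne_zero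
    (qdisc_ne_zero ha ha0)) (mul_ne_zero Φ.m_ne Φ.n_ne)) (mul_ne_zero (mul_ne_zero
    one_sub_sq_ne_zero (qdisc_ne_zero hb hb0)) (mul_ne_zero Ψ.m_ne Ψ.n_ne))
  have hbad : ∀ t : ℂ, aeval t e ≠ 0 → t ∉ Φ.bad ∧ t ∉ Ψ.bad := by
    intro t ht
    rw [he, map_mul, mul_ne_zero_iff] at ht
    refine ⟨fun h => ht.1 ?_, fun h => ht.2 ?_⟩
    · exact (mem_aroots.1 (Multiset.mem_toFinset.1 h)).2
    · exact (mem_aroots.1 (Multiset.mem_toFinset.1 h)).2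
  -- The image of a general point of `U` is on the polar curve of `b`.
  have himg : ∀ P ∈ U, aeval P.2 e ≠ 0 →
      value (pullForm H Ψ.α) P ^ 2 = aeval P.2 (qdisc b) * value (pullForm H Ψ.γ) P ^ 2 ∧
      value (pullForm H Ψ.γ) P ≠ 0 := by
    intro P hP ht
    obtain ⟨hne, hmem⟩ := hmap P hP
    obtain ⟨hc, h3, hl⟩ := (mk_mem_polarCurve hne).1 (fixedCurve_subset hb hb0 Ψ (hU' hmem))
    obtain ⟨-, -, hm, hn⟩ := Ψ.of_notMem_bad hb hb0 (hbad _ ht).2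
    rw [value_pullForm, value_pullForm]
    exact ⟨Ψ.formα_sq hn h3 hc hl, Ψ.formγ_ne_zero hm hn h3 hc hl hne⟩
  -- The points of the parametrization belong to the curve of fixed points.
  have hpt : ∀ t : ℂ, aeval t e ≠ 0 → ∀ r : ℂ, r ^ 2 = aeval t (qdisc a) →
      ∃ hne : Φ.pt t r ≠ 0, ((Projectivization.mk ℂ (Φ.pt t r) hne, t) : Pt) ∈ zariskiClosure U := by
    intro t ht r hr
    obtain ⟨-, -, hm, -⟩ := Φ.of_notMem_bad ha ha0 (hbad t ht).1
    refine ⟨Φ.pt_ne_zero hm r, hU (mem_fixedCurve ha ha0 Φ ?_ (hbad t ht).1)⟩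
    exact (mk_mem_polarCurve _).2 ⟨Φ.pt_mem_cone hr, Φ.pt_three t r, Φ.axisForm_pt t r⟩
  obtain ⟨x₀, x₁, hx⟩ := exists_linear_in_root Φ.base Φ.dir (qdisc a) (pullForm H Ψ.α)
  obtain ⟨y₀, y₁, hy⟩ := exists_linear_in_root Φ.base Φ.dir (qdisc a) (pullForm H Ψ.γ)
  have heq : ∀ t : ℂ, aeval t e ≠ 0 → ∀ r : ℂ, r ^ 2 = aeval t (qdisc a) →
      (aeval t x₀ + r * aeval t x₁) ^ 2
        = aeval t (qdisc b) * (aeval t y₀ + r * aeval t y₁) ^ 2 := by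
    intro t ht r hr
    obtain ⟨hne, hmem⟩ := hpt t ht r hr
    have hα := pullForm_isHomogeneous hH Ψ.α
    have hγ := pullForm_isHomogeneous hH Ψ.γ
    let f : MvPolynomial (Fin 4) ℝ[X] := MvPolynomial.C e * (pullForm H Ψ.α ^ 2
      - MvPolynomial.C (qdisc b) * pullForm H Ψ.γ ^ 2)
    have hf : f.IsHomogeneous (d * 2) := ((hα.pow 2).sub ((hγ.pow 2).C_mul _)).C_mul _
    have hval : ∀ P : Pt, value f P = aeval P.2 e * (value (pullForm H Ψ.α) P ^ 2
        - aeval P.2 (qdisc b) * value (pullForm H Ψ.γ) P ^ 2) := by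
      intro P
      simp only [f, value, MvPolynomial.eval₂_mul, MvPolynomial.eval₂_sub, MvPolynomial.eval₂_pow,
        MvPolynomial.eval₂_C, evBase_apply]
    have h0 := (value_mk hf hne t).1 (value_eq_zero_of_mem_closure hf (fun P hP => by
      rw [hval]
      by_cases h0 : aeval P.2 e = 0
      · rw [h0, zero_mul]
      · rw [(himg P hP h0).1, sub_self, mul_zero]) hmem)
    simp only [f, MvPolynomial.eval₂_mul, MvPolynomial.eval₂_sub, MvPolynomial.eval₂_pow,
      MvPolynomial.eval₂_C, evBase_apply] at h0
    have h1 := (mul_eq_zero.1 h0).resolve_left ht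
    have hx' := hx t r hr
    have hy' := hy t r hr
    change MvPolynomial.eval₂ _ (Φ.pt t r) _ = _ at hx' hy'
    rw [hx', hy'] at h1
    exact sub_eq_zero.1 h1
  have hy0 : ¬ (y₀ = 0 ∧ y₁ = 0) := by
    rintro ⟨rfl, rfl⟩
    obtain ⟨P, hP, hPe⟩ : ∃ P ∈ U, aeval P.2 e ≠ 0 := by
      by_contra! hall
      obtain ⟨t, ht⟩ := exists_aeval_ne_zero he0
      obtain ⟨r, hr⟩ := IsAlgClosed.exists_pow_nat_eq (aeval t (qdisc a)) (n := 2) (by norm_num)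
      obtain ⟨hne, hmem⟩ := hpt t ht r hr
      have := value_eq_zero_of_mem_closure (MvPolynomial.isHomogeneous_C (Fin 4) e)
        (fun P hP => by
          rw [value, MvPolynomial.eval₂_C]; exact hall P hP) hmem
      rw [value, MvPolynomial.eval₂_C] at this
      exact ht this
    obtain ⟨-, -, hm, hn⟩ := Φ.of_notMem_bad ha ha0 (hbad _ hPe).1
    have hpol := fixedCurve_subset ha ha0 Φ (hUa hP)
    obtain ⟨c, r, hr, hc⟩ := Φ.exists_eq_smul_pt hm hn hpol.1.2 hpol.1.1 hpol.2 P.1.rep_nonzero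
    apply (himg P hP hPe).2
    have hy' := hy P.2 r hr
    change MvPolynomial.eval₂ _ (Φ.pt P.2 r) _ = _ at hy'
    change MvPolynomial.eval₂ _ _ _ = 0
    rw [hc, eval₂_smul_of_isHomogeneous _ (pullForm_isHomogeneous hH Ψ.γ)]
    refine mul_eq_zero_of_right _ (hy'.trans ?_)
    simp
  -- The identity in the function field `ℝ(t)(r)`, where `r² = a²`.
  obtain ⟨e1, e2⟩ := eq_zero_of_root (d := qdisc a)
    (x := x₀ ^ 2 + qdisc a * x₁ ^ 2 - qdisc b * (y₀ ^ 2 + qdisc a * y₁ ^ 2))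
    (y := 2 * (x₀ * x₁ - qdisc b * (y₀ * y₁))) (qdisc_ne_zero ha ha0) (zeros e)
    (fun t ht r hr => by
      have := heq t (aeval_ne_zero_of_notMem he0 ht) r hr
      simp only [map_add, map_sub, map_mul, map_pow, map_ofNat]
      linear_combination this + (aeval t (qdisc b) * aeval t y₁ ^ 2 - aeval t x₁ ^ 2) * hr)
  -- Division of `x₀ + r x₁` by `y₀ + r y₁` shows that `b²` is the square of an element of this field,
  -- and one of the two coordinates of that element is zero.
  have hN : y₀ ^ 2 - qdisc a * y₁ ^ 2 ≠ 0 := fun h => hy0 (eq_zero_of_sq_eq ha ha0 h)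
  set N := y₀ ^ 2 - qdisc a * y₁ ^ 2 with hNdef
  have f1 : (x₀ * y₀ - qdisc a * (x₁ * y₁)) ^ 2 + qdisc a * (x₁ * y₀ - x₀ * y₁) ^ 2
      = qdisc b * N ^ 2 := by
    rw [hNdef]
    linear_combination (y₀ ^ 2 + qdisc a * y₁ ^ 2) * e1 - 2 * qdisc a * (y₀ * y₁) * e2
  have f2 : (x₀ * y₀ - qdisc a * (x₁ * y₁)) * (x₁ * y₀ - x₀ * y₁) = 0 := by
    have : 2 * ((x₀ * y₀ - qdisc a * (x₁ * y₁)) * (x₁ * y₀ - x₀ * y₁)) = 0 := by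
      linear_combination (y₀ ^ 2 + qdisc a * y₁ ^ 2) * e2 - 2 * (y₀ * y₁) * e1
    exact (mul_eq_zero.1 this).resolve_left two_ne_zero
  rcases mul_eq_zero.1 f2 with h | h
  · rw [h] at f1
    have f3 : qdisc a * (x₁ * y₀ - x₀ * y₁) ^ 2 = qdisc b * N ^ 2 := by linear_combination f1
    refine ⟨_, N, fun h0 => ?_, hN, f3⟩
    rw [h0] at f3
    exact mul_ne_zero (qdisc_ne_zero hb hb0) (pow_ne_zero 2 hN) (by rw [← f3]; ring)
  · -- Otherwise `b²` is a square, against the anisotropy of the norm.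
    rw [h] at f1
    exact absurd (eq_zero_of_sq_eq hb hb0 (x := x₀ * y₀ - qdisc a * (x₁ * y₁)) (y := N)
      (by linear_combination f1)).2 hN

end RealSphere

theorem mainTheorem4 (A B : RealSphere.BirOverBase) (hA : orderOf A = 2) (hB : orderOf B = 2) :
    IsConj A B ↔
      RealSphere.RealBirationalOverBase (RealSphere.fixedCurve A) (RealSphere.fixedCurve B) := by
  obtain ⟨a, ha0, ha, rfl⟩ := RealSphere.exists_pure_of_orderOf hA
  obtain ⟨b, hb0, hb, rfl⟩ := RealSphere.exists_pure_of_orderOf hB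
  constructor
  · exact RealSphere.realBirational_of_isConj ha hb ha0 hb0
  · rintro ⟨U, U', ⟨⟨Z, -, hUZ⟩, hU⟩, ⟨⟨Z', -, hUZ'⟩, -⟩, H, -, ⟨d, hH⟩, -, hmap, -, -, -⟩
    obtain ⟨x, y, hx, hy, h⟩ := RealSphere.exists_qdisc_mul_sq ha hb ha0 hb0 hU
      (hUZ ▸ Set.sdiff_subset) (hUZ' ▸ Set.sdiff_subset) hH hmap
    exact RealSphere.isConj_of_qdisc ha hb ha0 hb0 hx hy h
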